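/- Let $d\ge 2$, $0<\mu_1<\dots<\mu_d$ and $\rho>0$. For $\theta=(w^{(1)},w^{(2)})\in\mathbb R^d\times\mathbb R^d$ put $\beta_j=w^{(1)}_jw^{(2)}_j$ and $L(\theta)=\log\bigl(1+e^{-\langle\beta,\mu\rangle}\bigr)$. For $\alpha>0$ consider the SAM flow $$\dot\theta=-\nabla L\Bigl(\theta+\rho\,\frac{\nabla L(\theta)}{\|\nabla L(\theta)\|_2}\Bigr),\qquad w^{(1)}(0)=w^{(2)}(0)=\alpha\mathbf 1,$$ on an interval $[0,T)$, $0<T\le\infty$, along which $\nabla L(\theta)\neq0$; a solution is maximal if it cannot be extended to a longer such interval. Along a solution let $$m_c=\frac1{2\rho}\Bigl(\sum_j\mu_j^2\bigl((w_j^{(1)})^2+(w_j^{(2)})^2\bigr)\Bigr)^{1/2},\quad p_j=\frac{\mu_j^2\beta_j}{\sum_k\mu_k^2\beta_k},\quad M_r=\sum_j\mu_j^rp_j,\quad m_H=\frac{M_2}{2M_1},\quad m_L=\frac{\mu_1}2,$$ and let $\tau_F=\inf\{t\in[0,T):m_c(t)=m_L\}$ and $\tau_G=\inf\{t\in[0,T):m_c(t)=m_H(t)\}$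 in $[0,\infty]$, with $\inf\emptyset=\infty$. Put $$\alpha_0=\frac{\rho\,\mu_1}{\sqrt2\,\|\mu\|_2},\qquad \alpha_H=\frac{\rho\,\|\mu\|_4^4}{\sqrt2\,\|\mu\|_2\,\|\mu\|_3^3},\qquad \alpha_2=\frac{\rho\,(\mu_{d-1}+\mu_d)}{\sqrt2\,\|\mu\|_2}.$$ Say that a function decays exponentially on an interval $I$ if it is positive on $I$ and there is $c>0$ with $f(t)\le f(s)e^{-c(t-s)}$ for all $s\le t$ in $I$. For every $\alpha>0$ a maximal solution exists, and the following holds for every maximal solution. 1. (Regime 1-a) If $0<\alpha<\alpha_0$, then on $[0,T)$ one has $m_c(t)<m_L$, $m_c$ is strictly decreasing, and every $\beta_j$ decays exponentially. 2. There is $\alpha_1$ with $\alpha_0<\alpha_1<\alpha_H<\alpha_2$ such that: - (boundary trajectory) for $\alpha=\alpha_1$, $T=\infty$ and $m_L<m_c(t)<m_H(t)$ for all $t\ge0$; and $\alpha_1$ is unique: if for some $\alpha>0$ one has $m_L<m_c(t)<m_H(t)$ for all $t\in[0,T)$, then $\alpha=\alpha_1$; - (Regime 1-b, floor first) if $\alpha_0\le\alpha<\alpha_1$,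 then $\tau_F<\tau_G$, $m_c$ is strictly decreasing on $[0,T)$, $\tau_F<T$ is attained, and for every $t_0\in(\tau_F,T)$ one has $m_c(t_0)<m_L$ and every $\beta_j$ decays exponentially on $[t_0,T)$; - (Regime 2-a, ceiling first) if $\alpha_1<\alpha\le\alpha_H$, then $T=\infty$, $\tau_G<\tau_F$ (so $\tau_G<\infty$), $m_c$ is strictly decreasing on $[0,\tau_G]$ and strictly increasing on $[\tau_G,\infty)$, and $m_c(t)>m_H(t)$ for all $t>\tau_G$. 3. (Regimes 2-b and 3) If $\alpha>\alpha_H$, then $T=\infty$, $m_c(t)>m_H(t)$ for all $t\ge0$, and $m_c$ is strictly increasing on $[0,\infty)$. Moreover, for every $\alpha>0$, $\alpha<\alpha_2$ if and only if $m_c(0)<(\mu_{d-1}+\mu_d)/2$, and $\alpha>\alpha_2$ if and only if $m_c(0)>(\mu_{d-1}+\mu_d)/2$; if $\alpha>\alpha_2$, then $m_c(t)>(\mu_{d-1}+\mu_d)/2$ for all $t\ge0$. -/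

import Mathlib

open scoped Gradient

noncomputable section

namespace SAMFlow

/-- Parameters of the depth-2 diagonal linear network with `d` features:
`θ (0, j)` is the `j`-th weight of the first layer, `θ (1, j)` that of the second. -/
abbrev Params (d : ℕ) : Type := EuclideanSpace ℝ (Fin 2 × Fin d)

/-- The effective coefficient `β_j`. -/
def beta {d : ℕ} (θ : Params d) (j : Fin d) : ℝ := θ (0, j) * θ (1, j)

/-- The margin `⟨β, μ⟩`. -/
def margin {d : ℕ} (μ : Fin d → ℝ) (θ : Params d) : ℝ := ∑ j, beta θ j * μ j

/-- The logistic loss of a margin. -/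
def logistic (s : ℝ) : ℝ := Real.log (1 + Real.exp (-s))

/-- The training loss. -/
def loss {d : ℕ} (μ : Fin d → ℝ) (θ : Params d) : ℝ := logistic (margin μ θ)

/-- The perturbed parameter: a step of length `ρ` along the normalized gradient. -/
def perturbed {d : ℕ} (μ : Fin d → ℝ) (ρ : ℝ) (θ : Params d) : Params d :=
  θ + (ρ / ‖∇ (loss μ) θ‖) • ∇ (loss μ) θ

/-- The time interval `[0, T)`, where `T` may be infinite. -/
def lifespan (T : EReal) : Set ℝ := {t : ℝ | 0 ≤ t ∧ (t : EReal) < T}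

/-- `θ` solves the SAM flow `θ' = -∇ L (θ + ρ ∇ L(θ) / ‖∇ L(θ)‖)` on `[0, T)`, starting with all
weights equal to `α`. The normalized gradient has to be defined along the solution. -/
structure IsFlow {d : ℕ} (μ : Fin d → ℝ) (ρ α : ℝ) (T : EReal) (θ : ℝ → Params d) : Prop where
  pos : 0 < T
  init : ∀ i, θ 0 i = α
  grad_ne_zero : ∀ t ∈ lifespan T, ∇ (loss μ) (θ t) ≠ 0
  deriv : ∀ t ∈ lifespan T,
    HasDerivWithinAt θ (-∇ (loss μ) (perturbed μ ρ (θ t))) (Set.Ici 0) t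

/-- A solution of the SAM flow that has no extension to a longer interval. -/
structure IsMaximalFlow {d : ℕ} (μ : Fin d → ℝ) (ρ α : ℝ) (T : EReal) (θ : ℝ → Params d) : Prop
    extends IsFlow μ ρ α T θ where
  maximal : ∀ (T' : EReal) (θ' : ℝ → Params d), IsFlow μ ρ α T' θ' →
    (∀ t ∈ lifespan T, θ' t = θ t) → T' ≤ T

/-- `n_θ`, the square root of `∑ μ_j² ((w⁽¹⁾_j)² + (w⁽²⁾_j)²)`. -/
def nTheta {d : ℕ} (μ : Fin d → ℝ) (θ : Params d) : ℝ :=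
  Real.sqrt (∑ j, μ j ^ 2 * (θ (0, j) ^ 2 + θ (1, j) ^ 2))

/-- The center `m_c = n_θ / (2 ρ)`. -/
def mc {d : ℕ} (μ : Fin d → ℝ) (ρ : ℝ) (θ : Params d) : ℝ := nTheta μ θ / (2 * ρ)

/-- The normalized weights `p_j`. -/
def prop {d : ℕ} (μ : Fin d → ℝ) (θ : Params d) (j : Fin d) : ℝ :=
  μ j ^ 2 * beta θ j / ∑ k, μ k ^ 2 * beta θ k

/-- The moments `M_r = ∑ μ_j^r p_j`. -/
def moment {d : ℕ} (μ : Fin d → ℝ) (r : ℕ) (θ : Params d) : ℝ := ∑ j, μ j ^ r * prop μ θ j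

/-- The ceiling `m_H = M₂ / (2 M₁)`. -/
def mH {d : ℕ} (μ : Fin d → ℝ) (θ : Params d) : ℝ := moment μ 2 θ / (2 * moment μ 1 θ)

/-- The floor `m_L = μ₁ / 2`. -/
def mL {k : ℕ} (μ : Fin (k + 2) → ℝ) : ℝ := μ 0 / 2

/-- The midpoint `(μ_{d-1} + μ_d) / 2` of the two largest features, `d = k + 2`. -/
def mTop {k : ℕ} (μ : Fin (k + 2) → ℝ) : ℝ :=
  (μ (Fin.last k).castSucc + μ (Fin.last (k + 1))) / 2

/-- The first time in `[0, T)` at which `P` holds; `⊤` if there is none. -/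
def hittingTime (T : EReal) (P : ℝ → Prop) : EReal :=
  sInf ((fun t : ℝ => (t : EReal)) '' {t | t ∈ lifespan T ∧ P t})

/-- The floor hitting time `τ_F`. -/
def tauF {k : ℕ} (μ : Fin (k + 2) → ℝ) (ρ : ℝ) (T : EReal) (θ : ℝ → Params (k + 2)) : EReal :=
  hittingTime T fun t => mc μ ρ (θ t) = mL μ

/-- The ceiling hitting time `τ_G`. -/
def tauG {d : ℕ} (μ : Fin d → ℝ) (ρ : ℝ) (T : EReal) (θ : ℝ → Params d) : EReal :=
  hittingTime T fun t => mc μ ρ (θ t) - mH μ (θ t) = 0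

/-- `f` is positive and decays exponentially on `I`, at some rate `c > 0` between any two times. -/
def ExpDecayOn (f : ℝ → ℝ) (I : Set ℝ) : Prop :=
  (∀ t ∈ I, 0 < f t) ∧
    ∃ c : ℝ, 0 < c ∧ ∀ s ∈ I, ∀ t ∈ I, s ≤ t → f t ≤ f s * Real.exp (-c * (t - s))

/-- `‖μ‖₂` -/
def norm2 {d : ℕ} (μ : Fin d → ℝ) : ℝ := Real.sqrt (∑ j, μ j ^ 2)

/-- `α₀ = ρ μ₁ / (√2 ‖μ‖₂)` -/
def alpha0 {k : ℕ} (μ : Fin (k + 2) → ℝ) (ρ : ℝ) : ℝ := ρ * μ 0 / (Real.sqrt 2 * norm2 μ)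

/-- `α_H = ρ ‖μ‖₄⁴ / (√2 ‖μ‖₂ ‖μ‖₃³)`; the features are positive. -/
def alphaH {d : ℕ} (μ : Fin d → ℝ) (ρ : ℝ) : ℝ :=
  ρ * (∑ j, μ j ^ 4) / (Real.sqrt 2 * norm2 μ * ∑ j, μ j ^ 3)

/-- `α₂ = ρ (μ_{d-1} + μ_d) / (√2 ‖μ‖₂)`, `d = k + 2`. -/
def alpha2 {k : ℕ} (μ : Fin (k + 2) → ℝ) (ρ : ℝ) : ℝ :=
  ρ * (μ (Fin.last k).castSucc + μ (Fin.last (k + 1))) / (Real.sqrt 2 * norm2 μ)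

end SAMFlow

end

/-!
As both layers start equal they stay equal, and the flow becomes an autonomous equation for the
vector `y` with `β_j = exp (2 y_j)`. There `m_c` moves with the sign of `m_c - m_H`. Where
`m_c = m_H`, the velocity of the ceiling is minus a variance of `μ` up to a positive factor; hence a
trajectory crosses the ceiling only upwards. As `m_L < m_H`, it crosses the floor only downwards.
The sets of initial scales whose trajectories get below the floor, respectively above the ceiling,
are therefore disjoint; they are open, and they contain all small, respectively all large, scales.

At most one scale is in neither set. After a change of time the trajectory from the constant vector
`a` is `a + μ s - μ² r` with `r' = 1 / (2 m_c)`, so that two trajectories can be compared through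
the single function `r`: the one with the larger `a` has the smaller `r`, and its center is larger
by a constant factor. Both cannot remain between the floor and the ceiling.
-/

noncomputable section

namespace SAMFlow

open Set Filter Topology Metric
open scoped NNReal

section Calculus

variable {S : Set ℝ} {f f' g : ℝ → ℝ}

theorem exists_eq_Iio_Ioi {P Q : Set ℝ} (hP : IsOpen P) (hQ : IsOpen Q) (hPQ : Disjoint P Q)
    (hsub : (P ∪ Q)ᶜ.Subsingleton) (hbot : ∀ᶠ x in atBot, x ∈ P) (htop : ∀ᶠ x in atTop, x ∈ Q) :
    ∃ c, P = Iio c ∧ Q = Ioi c := by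
  obtain ⟨c, hc⟩ : (P ∪ Q)ᶜ.Nonempty := by
    by_contra! hempty
    obtain ⟨x, -, hxP, hxQ⟩ := isPreconnected_univ (α := ℝ) P Q hP hQ
      (compl_empty_iff.1 hempty).ge (by rw [univ_inter]; exact hbot.exists)
      (by rw [univ_inter]; exact htop.exists)
    exact disjoint_left.1 hPQ hxP hxQ
  have hcover : ∀ x, x ≠ c → x ∈ P ∪ Q := fun x hx => by
    by_contra hx'
    exact hx (hsub hx' hc)
  have hIio : Iio c ⊆ P := isPreconnected_Iio.subset_left_of_subset_union hP hQ hPQ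
    (fun x hx => hcover x (ne_of_lt hx)) ((eventually_lt_atBot c).and hbot).exists
  have hIoi : Ioi c ⊆ Q := isPreconnected_Ioi.subset_right_of_subset_union hP hQ hPQ
    (fun x hx => hcover x (ne_of_gt hx)) ((eventually_gt_atTop c).and htop).exists
  refine ⟨c, hIio.antisymm' fun x hx => ?_, hIoi.antisymm' fun x hx => ?_⟩
  · rcases lt_trichotomy x c with h | rfl | h
    · exact h
    · exact absurd (Or.inl hx) hc
    · exact absurd (hIoi h) (disjoint_left.1 hPQ hx)
  · rcases lt_trichotomy x c with h | rfl | h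
    · exact absurd hx (disjoint_left.1 hPQ (hIio h))
    · exact absurd (Or.inr hx) hc
    · exact h

theorem pos_of_nonneg_of_deriv_pos_of_eq_zero (hS : S.OrdConnected)
    (hf : ∀ t ∈ S, HasDerivWithinAt f (f' t) S t) (hcross : ∀ t ∈ S, f t = 0 → 0 < f' t)
    {a b : ℝ} (ha : a ∈ S) (hb : b ∈ S) (hab : a < b) (h : 0 ≤ f a) : 0 < f b := by
  have hsub : Icc a b ⊆ S := hS.out ha hb
  have hderiv : ∀ t ∈ Icc a b, HasDerivWithinAt f (f' t) (Icc a b) t := fun t ht =>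
    (hf t (hsub ht)).mono hsub
  have hnonneg : ∀ ⦃t⦄, t ∈ Icc a b → 0 ≤ f t :=
    image_le_of_deriv_right_lt_deriv_boundary' (f := fun _ => 0) (f' := fun _ => 0) (B' := f')
      continuousOn_const (fun t _ => hasDerivWithinAt_const t _ 0) h
      (fun t ht => (hderiv t ht).continuousWithinAt)
      (fun t ht => ((hderiv t (Ico_subset_Icc_self ht)).mono
        (Icc_subset_Icc_left ht.1)).mono_of_mem_nhdsWithin (Icc_mem_nhdsGE ht.2))
      fun t ht h0 => hcross t (hsub (Ico_subset_Icc_self ht)) h0.symm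
  refine (hnonneg ⟨hab.le, le_rfl⟩).lt_of_ne' fun hzero => ?_
  have hmin : IsLocalMinOn f (Icc a b) b :=
    eventually_nhdsWithin_of_forall fun t ht => hzero.le.trans (hnonneg ht)
  have hslope := hmin.hasFDerivWithinAt_nonneg (hderiv b ⟨hab.le, le_rfl⟩).hasFDerivWithinAt
    (sub_mem_posTangentConeAt_of_segment_subset (y := a)
      (by rw [segment_symm, segment_eq_Icc hab.le]))
  simp only [ContinuousLinearMap.toSpanSingleton_apply, smul_eq_mul] at hslope
  nlinarith [hcross b hb hzero]

theorem exists_eq_mul_exp_of_linear {u c : ℝ → ℝ} {a b : ℝ} (hab : a ≤ b)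
    (hu : ∀ x ∈ Icc a b, HasDerivWithinAt u (c x * u x) (Icc a b) x)
    (hc : ContinuousOn c (Icc a b)) : ∃ l, u b = u a * Real.exp l := by
  have hext : Continuous (IccExtend hab (domRestrict (Icc a b) c)) :=
    (continuousOn_iff_continuous_domRestrict.1 hc).Icc_extend'
  set A : ℝ → ℝ := fun x => ∫ s in a..x, IccExtend hab (domRestrict (Icc a b) c) s
  have hA' : ∀ x ∈ Icc a b, HasDerivWithinAt A (c x) (Icc a b) x := fun x hx => by
    simpa only [IccExtend_of_mem _ _ hx, domRestrict_apply] using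
      (hext.integral_hasStrictDerivAt a x).hasDerivAt.hasDerivWithinAt (s := Icc a b)
  have hconst : ∀ x ∈ Icc a b,
      HasDerivWithinAt (fun x => u x * Real.exp (-A x)) 0 (Icc a b) x := fun x hx =>
    ((hu x hx).fun_mul (hA' x hx).fun_neg.exp).congr_deriv (by ring)
  have heq := (convex_Icc a b).norm_image_sub_le_of_norm_hasDerivWithin_le (C := 0) hconst
    (fun _ _ => norm_zero.le) (left_mem_Icc.2 hab) (right_mem_Icc.2 hab)
  have hAa : A a = 0 := intervalIntegral.integral_same
  rw [zero_mul, norm_le_zero_iff, hAa, neg_zero, Real.exp_zero, mul_one, sub_eq_zero] at heq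
  exact ⟨A b, by rw [← heq, mul_assoc, ← Real.exp_add, neg_add_cancel, Real.exp_zero, mul_one]⟩

theorem expDecayOn_exp (hS : S.OrdConnected)
    (hf : ∀ t ∈ S, HasDerivWithinAt f (f' t) S t) {c : ℝ} (hc : 0 < c)
    (hle : ∀ t ∈ S, f' t ≤ -c) : ExpDecayOn (fun t => Real.exp (f t)) S := by
  have hanti : AntitoneOn (fun t => f t + c * t) S :=
    antitoneOn_of_hasDerivWithinAt_nonpos hS.convex
      (fun t ht => ((hf t ht).continuousWithinAt).add (by fun_prop))
      (fun t ht => ((hf t (interior_subset ht)).mono interior_subset).fun_add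
        ((hasDerivWithinAt_id t _).const_mul c))
      fun t ht => by linarith [hle t (interior_subset ht)]
  refine ⟨fun t _ => Real.exp_pos _, c, hc, fun s hs t ht hst => ?_⟩
  have hst' : f t + c * t ≤ f s + c * s := hanti hs ht hst
  rw [← Real.exp_add]
  exact Real.exp_le_exp.2 (by linarith)

theorem ExpDecayOn.congr (h : ExpDecayOn f S) (hfg : EqOn f g S) : ExpDecayOn g S := by
  obtain ⟨hpos, c, hc, hle⟩ := h
  refine ⟨fun t ht => hfg ht ▸ hpos t ht, c, hc, fun s hs t ht hst => ?_⟩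
  rw [← hfg hs, ← hfg ht]
  exact hle s hs t ht hst

end Calculus

section Lifespan

theorem lifespan_mono {T T' : EReal} (h : T ≤ T') : lifespan T ⊆ lifespan T' :=
  fun _ ht => ⟨ht.1, ht.2.trans_le h⟩

theorem zero_mem_lifespan {T : EReal} (h : 0 < T) : (0 : ℝ) ∈ lifespan T :=
  ⟨le_rfl, by simpa using h⟩

@[simp]
theorem mem_lifespan_coe {t b : ℝ} : t ∈ lifespan (b : EReal) ↔ 0 ≤ t ∧ t < b := by
  simp [lifespan]

@[simp]
theorem lifespan_top : lifespan ⊤ = Ici 0 := by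
  ext t
  simp [lifespan]

theorem mem_lifespan_of_le {T : EReal} {s t : ℝ} (hs : 0 ≤ s) (hst : s ≤ t)
    (ht : t ∈ lifespan T) : s ∈ lifespan T :=
  ⟨hs, lt_of_le_of_lt (by exact_mod_cast hst) ht.2⟩

theorem Icc_subset_lifespan {T : EReal} {t : ℝ} (ht : t ∈ lifespan T) :
    Icc 0 t ⊆ lifespan T :=
  fun _ hs => mem_lifespan_of_le hs.1 hs.2 ht

theorem ordConnected_lifespan (T : EReal) : OrdConnected (lifespan T) :=
  ⟨fun _ hx _ hy _ hz => mem_lifespan_of_le (hx.1.trans hz.1) hz.2 hy⟩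

theorem exists_lt_mem_lifespan {T : EReal} {t : ℝ} (ht : t ∈ lifespan T) :
    ∃ t' ∈ lifespan T, t < t' := by
  obtain ⟨t', htt', ht'⟩ := EReal.lt_iff_exists_real_btwn.1 ht.2
  have hlt : t < t' := by exact_mod_cast htt'
  exact ⟨t', ⟨ht.1.trans hlt.le, ht'⟩, hlt⟩

theorem nhdsWithin_lifespan {T : EReal} {t : ℝ} (ht : t ∈ lifespan T) :
    𝓝[lifespan T] t = 𝓝[Ici 0] t := by
  obtain ⟨t', ht', hlt⟩ := exists_lt_mem_lifespan ht
  refine le_antisymm (nhdsWithin_mono t fun s hs => hs.1) (nhdsWithin_le_iff.2 ?_)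
  filter_upwards [self_mem_nhdsWithin, mem_nhdsWithin_of_mem_nhds (Iio_mem_nhds hlt)] with s hs hs'
  exact mem_lifespan_of_le hs (le_of_lt hs') ht'

theorem hasDerivWithinAt_lifespan_iff {E : Type*} [NormedAddCommGroup E] [NormedSpace ℝ E]
    {y : ℝ → E} {y' : E} {T : EReal} {t : ℝ} (ht : t ∈ lifespan T) :
    HasDerivWithinAt y y' (lifespan T) t ↔ HasDerivWithinAt y y' (Ici 0) t :=
  hasDerivWithinAt_congr_set (nhdsWithin_eq_iff_eventuallyEq.1 (nhdsWithin_lifespan ht))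

end Lifespan

section MaximalSolutions

variable {E : Type*} [NormedAddCommGroup E] [NormedSpace ℝ E] {f : E → E}

theorem eqOn_of_isIntegralCurveOn [ProperSpace E] (hf : LocallyLipschitz f) {T : EReal}
    {y z : ℝ → E} (hy : IsIntegralCurveOn y (fun _ => f) (lifespan T))
    (hz : IsIntegralCurveOn z (fun _ => f) (lifespan T)) (h0 : y 0 = z 0) :
    EqOn y z (lifespan T) := by
  intro t ht
  have hsub := Icc_subset_lifespan ht
  have hyc := hy.continuousOn.mono hsub
  have hzc := hz.continuousOn.mono hsub
  obtain ⟨R, hR⟩ := ((isCompact_Icc.image_of_continuousOn hyc).union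
    (isCompact_Icc.image_of_continuousOn hzc)).isBounded.subset_closedBall 0
  obtain ⟨K, hK⟩ := hf.locallyLipschitzOn.exists_lipschitzOnWith_of_compact
    (isCompact_closedBall (0 : E) R)
  have hderiv : ∀ {x : ℝ → E}, IsIntegralCurveOn x (fun _ => f) (lifespan T) → ∀ s ∈ Ico 0 t,
      HasDerivWithinAt x (f (x s)) (Ici s) s := fun hx s hs =>
    ((hasDerivWithinAt_lifespan_iff (hsub (Ico_subset_Icc_self hs))).1
      (hx s (hsub (Ico_subset_Icc_self hs)))).mono (Ici_subset_Ici.2 hs.1)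
  exact ODE_solution_unique_of_mem_Icc_right (v := fun _ => f) (s := fun _ => closedBall 0 R)
    (fun _ _ => hK) hyc (hderiv hy)
    (fun s hs => hR (Or.inl (mem_image_of_mem y (Ico_subset_Icc_self hs)))) hzc (hderiv hz)
    (fun s hs => hR (Or.inr (mem_image_of_mem z (Ico_subset_Icc_self hs)))) h0
    (right_mem_Icc.2 ht.1)

theorem exists_bounded_locallyLipschitz_eqOn [FiniteDimensional ℝ E] (hf : LocallyLipschitz f)
    (R : ℝ) : ∃ g : E → E, LocallyLipschitz g ∧ (∃ B : ℝ≥0, ∀ x, ‖g x‖ ≤ B) ∧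
      EqOn g f (closedBall 0 R) := by
  have := FiniteDimensional.proper_real E
  let φ : ContDiffBump (0 : E) := ⟨max R 1, max R 1 + 1, by positivity, lt_add_one _⟩
  obtain ⟨B, hB⟩ :=
    ((isCompact_closedBall (0 : E) φ.rOut).image hf.continuous).isBounded.exists_norm_le
  refine ⟨fun x => φ x • f x, ?_, ⟨B.toNNReal, fun x => ?_⟩, fun x hx => ?_⟩
  · exact (contDiff_smul (𝕜 := ℝ) (n := 1)).locallyLipschitz (𝕂 := ℝ) |>.comp
      ((φ.contDiff (n := 1)).locallyLipschitz.prodMk hf)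
  · beta_reduce
    refine le_trans ?_ (Real.le_coe_toNNReal B)
    have hB0 : 0 ≤ B := (norm_nonneg _).trans
      (hB _ (mem_image_of_mem f (mem_closedBall_self φ.rOut_pos.le)))
    by_cases hx : x ∈ closedBall 0 φ.rOut
    · rw [norm_smul, Real.norm_of_nonneg φ.nonneg]
      exact (mul_le_of_le_one_left (norm_nonneg _) φ.le_one).trans (hB _ (mem_image_of_mem f hx))
    · rwa [φ.zero_of_le_dist (not_le.1 hx).le, zero_smul, norm_zero]
  · simp only [φ.one_of_mem_closedBall (closedBall_subset_closedBall (le_max_left R 1) hx),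
      one_smul]

theorem isIntegralCurveOn_congr_field {g : E → E} {y : ℝ → E} {s : Set ℝ}
    (hy : IsIntegralCurveOn y (fun _ => f) s) (hfg : ∀ t ∈ s, f (y t) = g (y t)) :
    IsIntegralCurveOn y (fun _ => g) s :=
  fun t ht => (hy t ht).congr_deriv (hfg t ht)

theorem exists_lipschitz_flow_of_bounded [ProperSpace E] (hf : LocallyLipschitz f) {B : ℝ≥0}
    (hB : ∀ x, ‖f x‖ ≤ B) (x₀ : E) {b : ℝ} (hb : 0 ≤ b) :
    ∃ (Y : E → ℝ → E) (L : ℝ≥0), (∀ x ∈ closedBall x₀ 1,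
      Y x 0 = x ∧ IsIntegralCurveOn (Y x) (fun _ => f) (lifespan b)) ∧
      ∀ t ∈ lifespan b, LipschitzOnWith L (Y · t) (closedBall x₀ 1) := by
  lift b to ℝ≥0 using hb
  obtain ⟨K, hK⟩ := hf.locallyLipschitzOn.exists_lipschitzOnWith_of_compact
    (isCompact_closedBall x₀ (B * b + 1))
  have hPL : IsPicardLindelof (fun _ => f) (tmin := 0) (tmax := b) ⟨0, le_rfl, b.2⟩ x₀
      (B * b + 1) 1 B K :=
    { lipschitzOnWith := fun _ _ => by simpa using hK
      continuousOn := fun _ _ => continuousOn_const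
      norm_le := fun _ _ x _ => hB x
      mul_max_le := by simp }
  obtain ⟨Y, hY, L, hL⟩ := hPL.exists_forall_mem_closedBall_eq_hasDerivWithinAt_lipschitzOnWith
  have hsub : lifespan (b : ℝ) ⊆ Icc 0 (b : ℝ) := fun t ht =>
    ⟨ht.1, (mem_lifespan_coe.1 ht).2.le⟩
  exact ⟨Y, L, fun x hx => ⟨(hY x hx).1, fun t ht => ((hY x hx).2 t (hsub ht)).mono hsub⟩,
    fun t ht => hL t (hsub ht)⟩

theorem exists_norm_le_add_one_of_continuousOn {F : Type*} [SeminormedAddCommGroup F] {y : ℝ → F}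
    {b R : ℝ} (hb : 0 ≤ b) (hy : ContinuousOn y (lifespan (b + 1 : ℝ))) (h0 : ‖y 0‖ ≤ R)
    (hR : ∀ t ∈ lifespan b, ‖y t‖ ≤ R) :
    ∃ ε > 0, ε ≤ 1 ∧ ∀ t ∈ lifespan (b + ε : ℝ), ‖y t‖ ≤ R + 1 := by
  have hmem : b ∈ lifespan (b + 1 : ℝ) := mem_lifespan_coe.2 ⟨hb, lt_add_one b⟩
  have hcont : ContinuousWithinAt (fun t => ‖y t‖) (Ici 0) b := by
    rw [ContinuousWithinAt, ← nhdsWithin_lifespan hmem]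
    exact (hy b hmem).norm
  have hyb : ‖y b‖ ≤ R := by
    rcases hb.eq_or_lt with rfl | hb
    · exact h0
    · refine (hcont.mono fun t ht => ht.1).closure_le (s := Ico 0 b) ?_ continuousWithinAt_const
        fun t ht => hR t (mem_lifespan_coe.2 ht)
      rw [closure_Ico hb.ne]
      exact right_mem_Icc.2 hb.le
  have hnhds : ∀ᶠ t in 𝓝[≥] b, ‖y t‖ < R + 1 :=
    (hcont.mono (Ici_subset_Ici.2 hb)).eventually (gt_mem_nhds (hyb.trans_lt (lt_add_one R)))
  obtain ⟨c, hbc, hc⟩ := mem_nhdsGE_iff_exists_Ico_subset.1 hnhds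
  refine ⟨min (c - b) 1, lt_min (sub_pos.2 hbc) one_pos, min_le_right _ _, fun t ht => ?_⟩
  obtain ⟨ht0, htb⟩ := mem_lifespan_coe.1 ht
  rcases lt_or_ge t b with h | h
  · linarith [hR t (mem_lifespan_coe.2 ⟨ht0, h⟩)]
  · exact (hc ⟨h, by linarith [min_le_left (c - b) 1]⟩).le

/-- A bounded solution on `[0, b)` is part of a Lipschitz local flow that lives beyond `b`. For
`b = 0` this is local existence, for `b` the end of the lifespan it is a continuation criterion, and
for `b` inside the lifespan it is continuous dependence on the initial value. -/
theorem exists_lipschitz_flow_of_norm_le [FiniteDimensional ℝ E] (hf : LocallyLipschitz f)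
    {b : ℝ} (hb : 0 ≤ b) {y : ℝ → E} (hy : IsIntegralCurveOn y (fun _ => f) (lifespan b)) {R : ℝ}
    (hR : ∀ t ∈ lifespan b, ‖y t‖ ≤ R) :
    ∃ ε > 0, ∃ δ > 0, ∃ (Y : E → ℝ → E) (L : ℝ≥0), (∀ x ∈ closedBall (y 0) δ,
      Y x 0 = x ∧ IsIntegralCurveOn (Y x) (fun _ => f) (lifespan (b + ε : ℝ))) ∧
      ∀ t ∈ lifespan (b + ε : ℝ), LipschitzOnWith L (Y · t) (closedBall (y 0) δ) := by
  have := FiniteDimensional.proper_real E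
  set R₀ := max R ‖y 0‖
  obtain ⟨g, hg, ⟨B, hB⟩, hgf⟩ := exists_bounded_locallyLipschitz_eqOn hf (R₀ + 2)
  obtain ⟨Y, L, hY, hL⟩ := exists_lipschitz_flow_of_bounded hg hB (y 0) (b := b + 1) (by positivity)
  have hmono : ∀ {ε : ℝ}, ε ≤ 1 → lifespan (b + ε : ℝ) ⊆ lifespan (b + 1 : ℝ) := fun hε =>
    lifespan_mono (by exact_mod_cast add_le_add_right hε b)
  have hy0 : y 0 ∈ closedBall (y 0) 1 := mem_closedBall_self zero_le_one
  have hYy : EqOn y (Y (y 0)) (lifespan b) :=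
    eqOn_of_isIntegralCurveOn hg
      (isIntegralCurveOn_congr_field hy fun t ht => (hgf (mem_closedBall_zero_iff.2
        ((hR t ht).trans (by linarith [le_max_left R ‖y 0‖])))).symm)
      ((hY _ hy0).2.mono (by simpa using hmono zero_le_one)) (hY _ hy0).1.symm
  obtain ⟨ε, hε, hε1, hYε⟩ := exists_norm_le_add_one_of_continuousOn hb (hY _ hy0).2.continuousOn
    (R := R₀) ((hY _ hy0).1.symm ▸ le_max_right R _)
    fun t ht => hYy ht ▸ (hR t ht).trans (le_max_left _ _)
  refine ⟨ε, hε, min 1 (L + 1 : ℝ)⁻¹, by positivity, Y, L, fun x hx => ?_, fun t ht =>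
    (hL t (hmono hε1 ht)).mono (closedBall_subset_closedBall (min_le_left _ _))⟩
  have hx1 := closedBall_subset_closedBall (min_le_left _ _) hx
  refine ⟨(hY x hx1).1, isIntegralCurveOn_congr_field ((hY x hx1).2.mono (hmono hε1))
    fun t ht => hgf ?_⟩
  have hdist : dist (Y x t) (Y (y 0) t) ≤ 1 := by
    calc dist (Y x t) (Y (y 0) t) ≤ L * dist x (y 0) :=
          (hL t (hmono hε1 ht)).dist_le_mul _ hx1 _ hy0
      _ ≤ (L + 1) * (L + 1 : ℝ)⁻¹ := by
        gcongr
        · exact (lt_add_one _).le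
        · exact hx.trans (min_le_right _ _)
      _ = 1 := mul_inv_cancel₀ (by positivity)
  rw [mem_closedBall_zero_iff]
  have := norm_le_norm_add_norm_sub' (Y x t) (Y (y 0) t)
  rw [dist_eq_norm] at hdist
  linarith [hYε t ht]

/-- `y` solves `y' = f y`, `y 0 = x₀` on `[0, T)`, and no solution with the same initial value lives
longer than `T`. -/
structure IsMaximalSolution (f : E → E) (x₀ : E) (T : EReal) (y : ℝ → E) : Prop where
  pos : 0 < T
  start : y 0 = x₀
  isIntegralCurveOn : IsIntegralCurveOn y (fun _ => f) (lifespan T)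
  maximal : ∀ (T' : EReal) (z : ℝ → E), z 0 = x₀ →
    IsIntegralCurveOn z (fun _ => f) (lifespan T') → T' ≤ T

variable {x₀ : E} {T T' : EReal} {y z : ℝ → E}

theorem exists_isIntegralCurveOn [FiniteDimensional ℝ E] (hf : LocallyLipschitz f) (x₀ : E) :
    ∃ ε : ℝ, 0 < ε ∧ ∃ y : ℝ → E, y 0 = x₀ ∧ IsIntegralCurveOn y (fun _ => f) (lifespan ε) := by
  have hempty : ∀ t, t ∉ lifespan (0 : ℝ) := fun t ht => by
    rw [mem_lifespan_coe] at ht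
    linarith
  obtain ⟨ε, hε, δ, hδ, Y, -, hY, -⟩ := exists_lipschitz_flow_of_norm_le hf le_rfl (R := 0)
    (y := fun _ => x₀) (fun t ht => (hempty t ht).elim) fun t ht => (hempty t ht).elim
  rw [zero_add] at hY
  exact ⟨ε, hε, Y x₀, hY x₀ (mem_closedBall_self hδ.le)⟩

theorem exists_isMaximalSolution [FiniteDimensional ℝ E] (hf : LocallyLipschitz f) (x₀ : E) :
    ∃ T y, IsMaximalSolution f x₀ T y := by
  have := FiniteDimensional.proper_real E
  let 𝒯 : Set EReal := {b | ∃ z : ℝ → E, z 0 = x₀ ∧ IsIntegralCurveOn z (fun _ => f) (lifespan b)}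
  obtain ⟨ε, hε, z₀, hz₀, hz₀'⟩ := exists_isIntegralCurveOn hf x₀
  have hpos : 0 < sSup 𝒯 :=
    lt_sSup_iff.2 ⟨ε, ⟨z₀, hz₀, hz₀'⟩, by exact_mod_cast hε⟩
  have hex : ∀ t, ∃ v, ∀ (b : EReal) (z : ℝ → E), z 0 = x₀ →
      IsIntegralCurveOn z (fun _ => f) (lifespan b) → t ∈ lifespan b → z t = v := fun t => by
    by_cases ht : ∃ b ∈ 𝒯, t ∈ lifespan b
    · obtain ⟨b, ⟨z, hz0, hz⟩, ht⟩ := ht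
      refine ⟨z t, fun b' z' hz0' hz' ht' => ?_⟩
      exact eqOn_of_isIntegralCurveOn hf (hz'.mono (lifespan_mono (min_le_right b b')))
        (hz.mono (lifespan_mono (min_le_left b b'))) (hz0'.trans hz0.symm)
        ⟨ht.1, lt_min ht.2 ht'.2⟩
    · exact ⟨0, fun b z hz0 hz htb => (ht ⟨b, ⟨z, hz0, hz⟩, htb⟩).elim⟩
  choose y hy using hex
  refine ⟨sSup 𝒯, y, hpos, ?_, fun t ht => ?_, fun T' z hz0 hz => le_sSup ⟨z, hz0, hz⟩⟩
  · exact (hy 0 ε z₀ hz₀ hz₀' (zero_mem_lifespan (by exact_mod_cast hε))).symm.trans hz₀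
  · obtain ⟨b, ⟨z, hz0, hz⟩, htb⟩ := lt_sSup_iff.1 ht.2
    have hyz : ∀ s ∈ lifespan b, y s = z s := fun s hs => (hy s b z hz0 hz hs).symm
    have htb' : t ∈ lifespan b := ⟨ht.1, htb⟩
    rw [hasDerivWithinAt_lifespan_iff ht, ← hasDerivWithinAt_lifespan_iff htb', hyz t htb']
    exact (hz t htb').congr hyz (hyz t htb')

theorem IsMaximalSolution.eqOn [ProperSpace E] (hf : LocallyLipschitz f)
    (hy : IsMaximalSolution f x₀ T y) (hz0 : z 0 = x₀)
    (hz : IsIntegralCurveOn z (fun _ => f) (lifespan T')) : EqOn z y (lifespan T') :=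
  eqOn_of_isIntegralCurveOn hf hz
    (hy.isIntegralCurveOn.mono (lifespan_mono (hy.maximal T' z hz0 hz))) (hz0.trans hy.start.symm)

theorem IsMaximalSolution.lifespan_eq (hy : IsMaximalSolution f x₀ T y)
    (hz : IsMaximalSolution f x₀ T' z) : T = T' :=
  le_antisymm (hz.maximal T y hy.start hy.isIntegralCurveOn)
    (hy.maximal T' z hz.start hz.isIntegralCurveOn)

theorem IsMaximalSolution.eq_top_of_norm_field_le [FiniteDimensional ℝ E] (hf : LocallyLipschitz f)
    (hy : IsMaximalSolution f x₀ T y) {B : ℝ} (hB : ∀ t ∈ lifespan T, ‖f (y t)‖ ≤ B) : T = ⊤ := by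
  by_contra hT
  lift T to ℝ using ⟨hT, (hy.pos.trans' EReal.bot_lt_zero).ne'⟩ with b
  have hb : 0 < b := by exact_mod_cast hy.pos
  have hbound : ∀ t ∈ lifespan b, ‖y t‖ ≤ ‖x₀‖ + B * b := fun t ht => by
    have hmvt := (ordConnected_lifespan b).convex.norm_image_sub_le_of_norm_hasDerivWithin_le
      hy.isIntegralCurveOn hB (zero_mem_lifespan hy.pos) ht
    have hB0 : 0 ≤ B := (norm_nonneg _).trans (hB t ht)
    obtain ⟨ht0, htb⟩ := mem_lifespan_coe.1 ht
    rw [hy.start, sub_zero, Real.norm_of_nonneg ht0] at hmvt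
    have := norm_le_norm_add_norm_sub' (y t) x₀
    linarith [mul_le_mul_of_nonneg_left htb.le hB0]
  obtain ⟨ε, hε, δ, hδ, Y, -, hY, -⟩ :=
    exists_lipschitz_flow_of_norm_le hf hb.le hy.isIntegralCurveOn hbound
  obtain ⟨hY0, hYsol⟩ := hY (y 0) (mem_closedBall_self hδ.le)
  have hle : b + ε ≤ b := by exact_mod_cast hy.maximal _ _ (hY0.trans hy.start) hYsol
  linarith

theorem IsMaximalSolution.eventually_mem [FiniteDimensional ℝ E] (hf : LocallyLipschitz f)
    (hy : IsMaximalSolution f x₀ T y) {t : ℝ} (ht : t ∈ lifespan T) {U : Set E} (hU : U ∈ 𝓝 (y t)) :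
    ∀ᶠ x in 𝓝 x₀, ∀ T' z, IsMaximalSolution f x T' z → t ∈ lifespan T' ∧ z t ∈ U := by
  have := FiniteDimensional.proper_real E
  have hsub : lifespan (t : ℝ) ⊆ lifespan T := lifespan_mono ht.2.le
  obtain ⟨R, hR⟩ := (isCompact_Icc.image_of_continuousOn
    (hy.isIntegralCurveOn.continuousOn.mono (Icc_subset_lifespan ht))).isBounded.exists_norm_le
  obtain ⟨ε, hε, δ, hδ, Y, L, hY, hL⟩ := exists_lipschitz_flow_of_norm_le hf ht.1
    (hy.isIntegralCurveOn.mono hsub) (R := R) fun s hs =>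
      hR _ (mem_image_of_mem y ⟨hs.1, (mem_lifespan_coe.1 hs).2.le⟩)
  rw [hy.start] at hY hL
  have htε : t ∈ lifespan (t + ε : ℝ) := mem_lifespan_coe.2 ⟨ht.1, by linarith⟩
  have hcont : ContinuousAt (Y · t) x₀ :=
    (hL t htε).continuousOn.continuousAt (closedBall_mem_nhds x₀ hδ)
  have hYt : Y x₀ t = y t := by
    obtain ⟨hY0, hYsol⟩ := hY x₀ (mem_closedBall_self hδ.le)
    exact hy.eqOn hf hY0 hYsol htε
  filter_upwards [closedBall_mem_nhds x₀ hδ, hcont.preimage_mem_nhds (hYt ▸ hU)]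
    with x hx hxU T' z hz
  obtain ⟨hY0, hYsol⟩ := hY x hx
  exact ⟨lifespan_mono (hz.maximal _ _ hY0 hYsol) htε, hz.eqOn hf hY0 hYsol htε ▸ hxU⟩

end MaximalSolutions

section Visits

variable {E : Type*} [NormedAddCommGroup E] [NormedSpace ℝ E] [FiniteDimensional ℝ E]
  {f : E → E} {x₀ : E} {T : EReal} {y : ℝ → E}

/-- The maximal solution of `y' = f y` from `x₀` enters the set `U`. -/
def Visits (f : E → E) (U : Set E) (x₀ : E) : Prop :=
  ∃ T y, IsMaximalSolution f x₀ T y ∧ ∃ t ∈ lifespan T, y t ∈ U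

theorem IsMaximalSolution.visits_iff (hf : LocallyLipschitz f) (hy : IsMaximalSolution f x₀ T y)
    (U : Set E) : Visits f U x₀ ↔ ∃ t ∈ lifespan T, y t ∈ U := by
  refine ⟨fun ⟨T', z, hz, t, ht, hU⟩ => ?_, fun h => ⟨T, y, hy, h⟩⟩
  obtain rfl := hz.lifespan_eq hy
  exact ⟨t, ht, hy.eqOn hf hz.start hz.isIntegralCurveOn ht ▸ hU⟩

theorem isOpen_setOf_visits (hf : LocallyLipschitz f) {U : Set E} (hU : IsOpen U) :
    IsOpen {x₀ | Visits f U x₀} := by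
  refine isOpen_iff_mem_nhds.2 fun x₀ ⟨T, y, hy, t, ht, hyt⟩ => ?_
  filter_upwards [hy.eventually_mem hf ht (hU.mem_nhds hyt)] with x hx
  obtain ⟨T', z, hz⟩ := exists_isMaximalSolution hf x
  exact ⟨T', z, hz, t, hx T' z hz⟩

end Visits

section LogCoordinates

variable {ι : Type*} {μ : ι → ℝ} {ρ : ℝ} {i : ι}

/-- The feature strength `μ i` is positive, smallest, and not the only one. The paper's `μ₁`,
whose half is the floor, is such a feature. -/
structure IsLeastFeature (μ : ι → ℝ) (i : ι) : Prop where
  pos : 0 < μ i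
  le : ∀ j, μ i ≤ μ j
  exists_lt : ∃ j, μ i < μ j

theorem IsLeastFeature.all_pos (hi : IsLeastFeature μ i) (j : ι) : 0 < μ j :=
  hi.pos.trans_le (hi.le j)

variable [Fintype ι]

/-- `∑ μ_j^n β_j` for the symmetric parameter with weights `exp (y_j)`. The moment `M_n` of the
paper is the quotient of the values at `n + 2` and at `2`. -/
def logMoment (μ : ι → ℝ) (n : ℕ) (y : ι → ℝ) : ℝ := ∑ j, μ j ^ n * Real.exp (2 * y j)

/-- The center `m_c` in logarithmic coordinates. -/
def logCenter (μ : ι → ℝ) (ρ : ℝ) (y : ι → ℝ) : ℝ :=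
  Real.sqrt (2 * logMoment μ 2 y) / (2 * ρ)

/-- The ceiling `m_H` in logarithmic coordinates. -/
def logCeiling (μ : ι → ℝ) (y : ι → ℝ) : ℝ := logMoment μ 4 y / (2 * logMoment μ 3 y)

/-- The inverse center `1 / (2 m_c)`, which is the relative length of the SAM perturbation. -/
def invCenter (μ : ι → ℝ) (ρ : ℝ) (y : ι → ℝ) : ℝ := (2 * logCenter μ ρ y)⁻¹

/-- The margin at the perturbed parameter in logarithmic coordinates. -/
def logMargin (μ : ι → ℝ) (ρ : ℝ) (y : ι → ℝ) : ℝ :=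
  ∑ j, μ j * Real.exp (2 * y j) * (1 - μ j * invCenter μ ρ y) ^ 2

/-- The absolute value of the derivative of the logistic function at the perturbed margin. It is
the factor by which all logarithmic coordinates are slowed down. -/
def gain (μ : ι → ℝ) (ρ : ℝ) (y : ι → ℝ) : ℝ := (1 + Real.exp (logMargin μ ρ y))⁻¹

/-- The SAM vector field in logarithmic coordinates. -/
def samField (μ : ι → ℝ) (ρ : ℝ) (y : ι → ℝ) : ι → ℝ :=
  fun j => gain μ ρ y * (μ j * (1 - μ j * invCenter μ ρ y))

theorem gain_pos (μ : ι → ℝ) (ρ : ℝ) (y : ι → ℝ) : 0 < gain μ ρ y := by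
  unfold gain; positivity

theorem gain_le_one (μ : ι → ℝ) (ρ : ℝ) (y : ι → ℝ) : gain μ ρ y ≤ 1 :=
  inv_le_one_of_one_le₀ (le_add_of_nonneg_right (Real.exp_pos _).le)

theorem contDiff_logMoment (μ : ι → ℝ) (n : ℕ) : ContDiff ℝ 1 (logMoment μ n) := by
  unfold logMoment; fun_prop

theorem logMoment_succ_le (hμ : ∀ j, 0 < μ j) (n : ℕ) (y : ι → ℝ) :
    logMoment μ (n + 1) y ≤ ‖μ‖ * logMoment μ n y := by
  simp only [logMoment, Finset.mul_sum]
  refine Finset.sum_le_sum fun j _ => ?_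
  rw [pow_succ', mul_assoc]
  have hj := hμ j
  gcongr
  exact (le_abs_self _).trans (norm_le_pi_norm μ j)

theorem IsLeastFeature.mul_logMoment_lt (hi : IsLeastFeature μ i) (n : ℕ) (y : ι → ℝ) :
    μ i * logMoment μ n y < logMoment μ (n + 1) y := by
  simp only [logMoment, Finset.mul_sum, pow_succ', mul_assoc]
  have hw : ∀ j, 0 < μ j ^ n * Real.exp (2 * y j) := fun j =>
    mul_pos (pow_pos (hi.all_pos j) n) (Real.exp_pos _)
  obtain ⟨j, hj⟩ := hi.exists_lt
  exact Finset.sum_lt_sum (fun j _ => mul_le_mul_of_nonneg_right (hi.le j) (hw j).le)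
    ⟨j, Finset.mem_univ j, mul_lt_mul_of_pos_right hj (hw j)⟩

variable [Nonempty ι]

theorem logMoment_pos (hμ : ∀ j, 0 < μ j) (n : ℕ) (y : ι → ℝ) : 0 < logMoment μ n y :=
  Finset.sum_pos (fun j _ => mul_pos (pow_pos (hμ j) n) (Real.exp_pos _)) Finset.univ_nonempty

theorem logCenter_pos (hμ : ∀ j, 0 < μ j) (hρ : 0 < ρ) (y : ι → ℝ) : 0 < logCenter μ ρ y := by
  have := logMoment_pos hμ 2 y
  unfold logCenter; positivity

theorem invCenter_pos (hμ : ∀ j, 0 < μ j) (hρ : 0 < ρ) (y : ι → ℝ) : 0 < invCenter μ ρ y := by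
  have := logCenter_pos hμ hρ y
  unfold invCenter; positivity

theorem logCenter_sq (hμ : ∀ j, 0 < μ j) (hρ : 0 < ρ) (y : ι → ℝ) :
    2 * ρ ^ 2 * logCenter μ ρ y ^ 2 = logMoment μ 2 y := by
  have := logMoment_pos hμ 2 y
  rw [logCenter, div_pow, Real.sq_sqrt (by positivity)]
  field_simp

theorem logCeiling_le (hμ : ∀ j, 0 < μ j) (y : ι → ℝ) : logCeiling μ y ≤ ‖μ‖ / 2 := by
  rw [logCeiling, div_le_div_iff₀ (by linarith [logMoment_pos hμ 3 y]) two_pos]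
  linarith [logMoment_succ_le hμ 3 y]

theorem IsLeastFeature.floor_lt_logCeiling (hi : IsLeastFeature μ i) (y : ι → ℝ) :
    μ i / 2 < logCeiling μ y := by
  rw [logCeiling, div_lt_div_iff₀ two_pos (by linarith [logMoment_pos hi.all_pos 3 y])]
  linarith [hi.mul_logMoment_lt 3 y]

theorem contDiff_logCenter (hμ : ∀ j, 0 < μ j) (ρ : ℝ) : ContDiff ℝ 1 (logCenter μ ρ) :=
  ((contDiff_const.mul (contDiff_logMoment μ 2)).sqrt fun y =>
    (mul_pos two_pos (logMoment_pos hμ 2 y)).ne').div_const _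

theorem contDiff_invCenter (hμ : ∀ j, 0 < μ j) (hρ : 0 < ρ) : ContDiff ℝ 1 (invCenter μ ρ) :=
  (contDiff_const.mul (contDiff_logCenter hμ ρ)).inv fun y =>
    (mul_pos two_pos (logCenter_pos hμ hρ y)).ne'

theorem continuous_logCeiling (hμ : ∀ j, 0 < μ j) : Continuous (logCeiling μ) :=
  (contDiff_logMoment μ 4).continuous.div
    (continuous_const.mul (contDiff_logMoment μ 3).continuous) fun y =>
      (mul_pos two_pos (logMoment_pos hμ 3 y)).ne'

theorem contDiff_gain (hμ : ∀ j, 0 < μ j) (hρ : 0 < ρ) : ContDiff ℝ 1 (gain μ ρ) := by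
  have hr := contDiff_invCenter hμ hρ
  have hm : ContDiff ℝ 1 (logMargin μ ρ) := by
    unfold logMargin; fun_prop
  exact (contDiff_const.add hm.exp).inv fun y => by positivity

theorem contDiff_samField (hμ : ∀ j, 0 < μ j) (hρ : 0 < ρ) : ContDiff ℝ 1 (samField μ ρ) := by
  have hr := contDiff_invCenter hμ hρ
  exact contDiff_pi.2 fun j => (contDiff_gain hμ hρ).mul (by fun_prop)

theorem norm_samField_le (hμ : ∀ j, 0 < μ j) (hρ : 0 < ρ) {y : ι → ℝ} {r : ℝ}
    (hr : invCenter μ ρ y ≤ r) : ‖samField μ ρ y‖ ≤ ‖μ‖ * (1 + ‖μ‖ * r) := by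
  have hr0 := invCenter_pos hμ hρ y
  have hr0' := hr0.le.trans hr
  refine (pi_norm_le_iff_of_nonneg (by positivity)).2 fun j => ?_
  have hj : |μ j| ≤ ‖μ‖ := norm_le_pi_norm μ j
  have hfactor : |1 - μ j * invCenter μ ρ y| ≤ 1 + ‖μ‖ * r :=
    calc |1 - μ j * invCenter μ ρ y| ≤ |1| + |μ j * invCenter μ ρ y| := abs_sub _ _
      _ = 1 + |μ j| * invCenter μ ρ y := by rw [abs_one, abs_mul, abs_of_pos hr0]
      _ ≤ 1 + ‖μ‖ * r := by gcongr
  calc ‖samField μ ρ y j‖ = gain μ ρ y * (|μ j| * |1 - μ j * invCenter μ ρ y|) := by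
        rw [samField, Real.norm_eq_abs, abs_mul, abs_mul, abs_of_pos (gain_pos μ ρ y)]
    _ ≤ 1 * (‖μ‖ * (1 + ‖μ‖ * r)) := by
        gcongr
        exact gain_le_one μ ρ y
    _ = ‖μ‖ * (1 + ‖μ‖ * r) := one_mul _

theorem logMargin_le (hμ : ∀ j, 0 < μ j) (hρ : 0 < ρ) (y : ι → ℝ) :
    logMargin μ ρ y ≤ ∑ j, (4 * ρ ^ 2 * logCenter μ ρ y ^ 2 / μ j + ρ ^ 2 * μ j) := by
  refine Finset.sum_le_sum fun j _ => ?_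
  have hj := hμ j
  have hm := logCenter_pos hμ hρ y
  set r := invCenter μ ρ y with hr
  have hβ : μ j ^ 2 * Real.exp (2 * y j) ≤ 2 * ρ ^ 2 * logCenter μ ρ y ^ 2 :=
    logCenter_sq hμ hρ y ▸ Finset.single_le_sum
      (f := fun j => μ j ^ 2 * Real.exp (2 * y j)) (fun _ _ => by positivity) (Finset.mem_univ j)
  have hrβ : (μ j * r) ^ 2 * Real.exp (2 * y j) ≤ ρ ^ 2 / 2 :=
    calc (μ j * r) ^ 2 * Real.exp (2 * y j) = r ^ 2 * (μ j ^ 2 * Real.exp (2 * y j)) := by ring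
      _ ≤ r ^ 2 * (2 * ρ ^ 2 * logCenter μ ρ y ^ 2) := by gcongr
      _ = ρ ^ 2 / 2 := by rw [hr, invCenter]; field_simp
  calc μ j * Real.exp (2 * y j) * (1 - μ j * r) ^ 2
      ≤ μ j * Real.exp (2 * y j) * (2 * (1 + (μ j * r) ^ 2)) := by
        gcongr; nlinarith [sq_nonneg (1 + μ j * r)]
    _ = 2 * (μ j ^ 2 * Real.exp (2 * y j) / μ j) +
          2 * μ j * ((μ j * r) ^ 2 * Real.exp (2 * y j)) := by field_simp
    _ ≤ 2 * (2 * ρ ^ 2 * logCenter μ ρ y ^ 2 / μ j) + 2 * μ j * (ρ ^ 2 / 2) := by gcongr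
    _ = 4 * ρ ^ 2 * logCenter μ ρ y ^ 2 / μ j + ρ ^ 2 * μ j := by ring

theorem exists_le_gain (hμ : ∀ j, 0 < μ j) (hρ : 0 < ρ) (B : ℝ) :
    ∃ c > 0, ∀ y, logCenter μ ρ y ≤ B → c ≤ gain μ ρ y := by
  refine ⟨(1 + Real.exp (∑ j, (4 * ρ ^ 2 * B ^ 2 / μ j + ρ ^ 2 * μ j)))⁻¹, by positivity,
    fun y hy => ?_⟩
  have hm := logCenter_pos hμ hρ y
  unfold gain
  gcongr
  refine (logMargin_le hμ hρ y).trans (Finset.sum_le_sum fun j _ => ?_)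
  have hj := hμ j
  gcongr

end LogCoordinates

section Dynamics

variable {ι : Type*} [Fintype ι] {μ : ι → ℝ} {ρ : ℝ} {i : ι} {S : Set ℝ} {y : ℝ → ι → ℝ}

theorem hasDerivWithinAt_logMoment {t : ℝ} (h : HasDerivWithinAt y (samField μ ρ (y t)) S t)
    (n : ℕ) :
    HasDerivWithinAt (fun t => logMoment μ n (y t)) (2 * gain μ ρ (y t) *
      (logMoment μ (n + 1) (y t) - invCenter μ ρ (y t) * logMoment μ (n + 2) (y t))) S t := by
  have hsum := HasDerivWithinAt.fun_sum (u := Finset.univ) fun j _ =>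
    ((hasDerivWithinAt_pi.1 h j).const_mul 2).exp.const_mul (μ j ^ n)
  refine hsum.congr_deriv ?_
  simp only [logMoment, samField, Finset.mul_sum, ← Finset.sum_sub_distrib]
  exact Finset.sum_congr rfl fun j _ => by ring

/-- The rate at which the flow drives the center away from the ceiling. -/
def centerRate (μ : ι → ℝ) (ρ : ℝ) (y : ι → ℝ) : ℝ :=
  gain μ ρ y * logMoment μ 3 y / logMoment μ 2 y

/-- The time derivative of the ceiling along the flow. -/
def ceilingVelocity (μ : ι → ℝ) (ρ : ℝ) (y : ι → ℝ) : ℝ :=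
  gain μ ρ y / logMoment μ 3 y ^ 2 *
    ((logMoment μ 5 y - invCenter μ ρ y * logMoment μ 6 y) * logMoment μ 3 y -
      logMoment μ 4 y * (logMoment μ 4 y - invCenter μ ρ y * logMoment μ 5 y))

theorem sum_mul_moment_deviation_sq (μ y : ι → ℝ) :
    ∑ j, μ j ^ 4 * Real.exp (2 * y j) * (logMoment μ 3 y * μ j - logMoment μ 4 y) ^ 2 =
      logMoment μ 3 y ^ 2 * logMoment μ 6 y -
        2 * logMoment μ 3 y * logMoment μ 4 y * logMoment μ 5 y + logMoment μ 4 y ^ 3 := by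
  generalize logMoment μ 3 y = a
  generalize hb : logMoment μ 4 y = b
  rw [pow_succ b 2]
  nth_rewrite 4 [← hb]
  simp only [logMoment, Finset.mul_sum, ← Finset.sum_sub_distrib, ← Finset.sum_add_distrib]
  exact Finset.sum_congr rfl fun j _ => by ring

variable [Nonempty ι]

theorem centerRate_pos (hμ : ∀ j, 0 < μ j) (ρ : ℝ) (y : ι → ℝ) : 0 < centerRate μ ρ y :=
  div_pos (mul_pos (gain_pos μ ρ y) (logMoment_pos hμ 3 y)) (logMoment_pos hμ 2 y)

theorem hasDerivWithinAt_logCenter (hμ : ∀ j, 0 < μ j) (hρ : 0 < ρ) {t : ℝ}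
    (h : HasDerivWithinAt y (samField μ ρ (y t)) S t) :
    HasDerivWithinAt (fun t => logCenter μ ρ (y t))
      (centerRate μ ρ (y t) * (logCenter μ ρ (y t) - logCeiling μ (y t))) S t := by
  have h2 := logMoment_pos hμ 2 (y t)
  have h3 := logMoment_pos hμ 3 (y t)
  have hm := logCenter_pos hμ hρ (y t)
  have hsqrt : Real.sqrt (2 * logMoment μ 2 (y t)) = 2 * ρ * logCenter μ ρ (y t) := by
    rw [logCenter]; field_simp
  refine ((((hasDerivWithinAt_logMoment h 2).const_mul 2).sqrt
    (by positivity)).div_const (2 * ρ)).congr_deriv ?_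
  rw [hsqrt, centerRate, ← logCenter_sq hμ hρ, logCeiling, invCenter]
  field_simp

theorem hasDerivWithinAt_logCeiling (hμ : ∀ j, 0 < μ j) {t : ℝ}
    (h : HasDerivWithinAt y (samField μ ρ (y t)) S t) :
    HasDerivWithinAt (fun t => logCeiling μ (y t)) (ceilingVelocity μ ρ (y t)) S t := by
  have h3 := logMoment_pos hμ 3 (y t)
  refine ((hasDerivWithinAt_logMoment h 4).fun_div
    ((hasDerivWithinAt_logMoment h 3).const_mul 2) (by positivity)).congr_deriv ?_
  unfold ceilingVelocity
  field_simp

theorem IsLeastFeature.ceilingVelocity_neg (hi : IsLeastFeature μ i) {y : ι → ℝ}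
    (h : logCenter μ ρ y = logCeiling μ y) : ceilingVelocity μ ρ y < 0 := by
  have h3 := logMoment_pos hi.all_pos 3 y
  have h4 := logMoment_pos hi.all_pos 4 y
  have hg := gain_pos μ ρ y
  have hvariance : 0 < ∑ j, μ j ^ 4 * Real.exp (2 * y j) *
      (logMoment μ 3 y * μ j - logMoment μ 4 y) ^ 2 := by
    have hw : ∀ j, 0 < μ j ^ 4 * Real.exp (2 * y j) := fun j =>
      mul_pos (pow_pos (hi.all_pos j) _) (Real.exp_pos _)
    refine Finset.sum_pos' (fun j _ => mul_nonneg (hw j).le (sq_nonneg _))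
      ⟨i, Finset.mem_univ i, mul_pos (hw i) (sq_pos_of_neg ?_)⟩
    linarith [hi.mul_logMoment_lt 3 y]
  have hr : invCenter μ ρ y = logMoment μ 3 y / logMoment μ 4 y := by
    rw [invCenter, h, logCeiling]
    field_simp
  have hvel : ceilingVelocity μ ρ y =
      -(gain μ ρ y / (logMoment μ 3 y ^ 2 * logMoment μ 4 y) *
        ∑ j, μ j ^ 4 * Real.exp (2 * y j) * (logMoment μ 3 y * μ j - logMoment μ 4 y) ^ 2) := by
    rw [ceilingVelocity, hr, sum_mul_moment_deviation_sq]
    field_simp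
    ring
  rw [hvel, neg_lt_zero]
  positivity

theorem IsLeastFeature.ceiling_lt_center (hi : IsLeastFeature μ i) (hρ : 0 < ρ)
    (hS : S.OrdConnected) (hy : IsIntegralCurveOn y (fun _ => samField μ ρ) S) {a b : ℝ}
    (ha : a ∈ S) (hb : b ∈ S) (hab : a < b) (h : logCeiling μ (y a) ≤ logCenter μ ρ (y a)) :
    logCeiling μ (y b) < logCenter μ ρ (y b) := by
  refine sub_pos.1 (pos_of_nonneg_of_deriv_pos_of_eq_zero hS
    (f := fun t => logCenter μ ρ (y t) - logCeiling μ (y t))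
    (fun t ht => (hasDerivWithinAt_logCenter hi.all_pos hρ (hy t ht)).fun_sub
      (hasDerivWithinAt_logCeiling hi.all_pos (hy t ht))) (fun t _ hzero => ?_)
    ha hb hab (sub_nonneg.2 h))
  rw [hzero, mul_zero, zero_sub, neg_pos]
  exact hi.ceilingVelocity_neg (sub_eq_zero.1 hzero)

theorem IsLeastFeature.center_lt_floor (hi : IsLeastFeature μ i) (hρ : 0 < ρ)
    (hS : S.OrdConnected) (hy : IsIntegralCurveOn y (fun _ => samField μ ρ) S) {a b : ℝ}
    (ha : a ∈ S) (hb : b ∈ S) (hab : a < b) (h : logCenter μ ρ (y a) ≤ μ i / 2) :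
    logCenter μ ρ (y b) < μ i / 2 := by
  refine sub_pos.1 (pos_of_nonneg_of_deriv_pos_of_eq_zero hS
    (f := fun t => μ i / 2 - logCenter μ ρ (y t))
    (fun t ht => (hasDerivWithinAt_logCenter hi.all_pos hρ (hy t ht)).const_sub (μ i / 2))
    (fun t _ hzero => ?_) ha hb hab (sub_nonneg.2 h))
  rw [← mul_neg, neg_sub]
  refine mul_pos (centerRate_pos hi.all_pos ρ (y t)) ?_
  linarith [hi.floor_lt_logCeiling (y t)]

theorem strictMonoOn_logCenter (hμ : ∀ j, 0 < μ j) (hρ : 0 < ρ) (hS : S.OrdConnected)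
    (hy : IsIntegralCurveOn y (fun _ => samField μ ρ) S)
    (h : ∀ t ∈ interior S, logCeiling μ (y t) < logCenter μ ρ (y t)) :
    StrictMonoOn (fun t => logCenter μ ρ (y t)) S := by
  have hd := fun t ht => hasDerivWithinAt_logCenter hμ hρ (hy t ht)
  exact strictMonoOn_of_hasDerivWithinAt_pos hS.convex
    (fun t ht => (hd t ht).continuousWithinAt)
    (fun t ht => (hd t (interior_subset ht)).mono interior_subset)
    fun t ht => mul_pos (centerRate_pos hμ ρ (y t)) (sub_pos.2 (h t ht))

theorem strictAntiOn_logCenter (hμ : ∀ j, 0 < μ j) (hρ : 0 < ρ) (hS : S.OrdConnected)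
    (hy : IsIntegralCurveOn y (fun _ => samField μ ρ) S)
    (h : ∀ t ∈ interior S, logCenter μ ρ (y t) < logCeiling μ (y t)) :
    StrictAntiOn (fun t => logCenter μ ρ (y t)) S := by
  have hd := fun t ht => hasDerivWithinAt_logCenter hμ hρ (hy t ht)
  exact strictAntiOn_of_hasDerivWithinAt_neg hS.convex
    (fun t ht => (hd t ht).continuousWithinAt)
    (fun t ht => (hd t (interior_subset ht)).mono interior_subset)
    fun t ht => mul_neg_of_pos_of_neg (centerRate_pos hμ ρ (y t)) (sub_neg.2 (h t ht))

theorem IsLeastFeature.exists_samField_le_neg (hi : IsLeastFeature μ i) (hρ : 0 < ρ) {m : ℝ}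
    (hm : m < μ i / 2) :
    ∃ c > 0, ∀ y, logCenter μ ρ y ≤ m → ∀ j, samField μ ρ y j ≤ -c := by
  rcases le_or_gt m 0 with hm0 | hm0
  · exact ⟨1, one_pos, fun y hy =>
      absurd (hy.trans hm0) (logCenter_pos hi.all_pos hρ y).not_ge⟩
  obtain ⟨g, hg, hgain⟩ := exists_le_gain hi.all_pos hρ m
  have hexcess : 0 < μ i * (2 * m)⁻¹ - 1 := by
    rw [sub_pos, ← div_eq_mul_inv, one_lt_div (by positivity)]
    linarith
  refine ⟨g * (μ i * (μ i * (2 * m)⁻¹ - 1)), mul_pos hg (mul_pos hi.pos hexcess),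
    fun y hy j => ?_⟩
  have hc := logCenter_pos hi.all_pos hρ y
  have hr : (2 * m)⁻¹ ≤ invCenter μ ρ y := by unfold invCenter; gcongr
  have hj := hi.all_pos j
  calc samField μ ρ y j = -(gain μ ρ y * (μ j * (μ j * invCenter μ ρ y - 1))) := by
        rw [samField]; ring
    _ ≤ -(g * (μ i * (μ i * (2 * m)⁻¹ - 1))) := by
        gcongr
        exacts [(mul_pos hi.pos hexcess).le, (gain_pos μ ρ y).le, hgain y hy, hi.le j, hi.le j]

theorem IsLeastFeature.expDecayOn (hi : IsLeastFeature μ i) (hρ : 0 < ρ) (hS : S.OrdConnected)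
    (hy : IsIntegralCurveOn y (fun _ => samField μ ρ) S) {a : ℝ} (ha : IsLeast S a)
    (h : logCenter μ ρ (y a) < μ i / 2) (j : ι) :
    ExpDecayOn (fun t => Real.exp (2 * y t j)) S := by
  have hfloor : ∀ t ∈ S, logCenter μ ρ (y t) < μ i / 2 := fun t ht =>
    (ha.2 ht).eq_or_lt.elim (fun hat => hat ▸ h)
      fun hat => hi.center_lt_floor hρ hS hy ha.1 ht hat h.le
  have hanti := (strictAntiOn_logCenter hi.all_pos hρ hS hy fun t ht =>
    (hfloor t (interior_subset ht)).trans (hi.floor_lt_logCeiling (y t))).antitoneOn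
  obtain ⟨c, hc, hle⟩ := hi.exists_samField_le_neg hρ h
  exact expDecayOn_exp hS (fun t ht => (hasDerivWithinAt_pi.1 (hy t ht) j).const_mul 2)
    (mul_pos two_pos hc) fun t ht => by linarith [hle (y t) (hanti ha.1 ht (ha.2 ht)) j]

theorem IsMaximalSolution.eq_top_of_le_logCenter (hμ : ∀ j, 0 < μ j) (hρ : 0 < ρ) {x₀ : ι → ℝ}
    {T : EReal} (hy : IsMaximalSolution (samField μ ρ) x₀ T y) {c : ℝ} (hc : 0 < c)
    (hle : ∀ t ∈ lifespan T, c ≤ logCenter μ ρ (y t)) : T = ⊤ :=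
  hy.eq_top_of_norm_field_le (contDiff_samField hμ hρ).locallyLipschitz fun t ht =>
    norm_samField_le hμ hρ (r := (2 * c)⁻¹) <| by
      have := hle t ht
      unfold invCenter; gcongr

end Dynamics

section TimeChange

theorem exists_inverse_of_le_deriv {s s' : ℝ → ℝ} (hs : ∀ t, HasDerivAt s (s' t) t) {c : ℝ}
    (hc : 0 < c) (hle : ∀ t, c ≤ s' t) :
    ∃ σ : ℝ → ℝ, Monotone σ ∧ (∀ t, σ (s t) = t) ∧ ∀ x, HasDerivAt σ (s' (σ x))⁻¹ x := by
  have hcont : Continuous s := continuous_iff_continuousAt.2 fun t => (hs t).continuousAt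
  have hlin : Monotone fun t => s t - c * t :=
    monotone_of_hasDerivAt_nonneg (f' := fun t => s' t - c)
      (fun t => by simpa using (hs t).fun_sub ((hasDerivAt_id t).const_mul c))
      fun t => sub_nonneg.2 (hle t)
  have hmono : StrictMono s := fun x y hxy => by
    have hxy' : s x - c * x ≤ s y - c * y := hlin hxy.le
    nlinarith
  have htop : Tendsto s atTop atTop :=
    tendsto_atTop_mono' atTop ((eventually_ge_atTop 0).mono fun t ht => by
      have h0t : s 0 - c * 0 ≤ s t - c * t := hlin ht
      change s 0 + c * t ≤ s t
      linarith) (tendsto_atTop_add_const_left _ _ (tendsto_id.const_mul_atTop hc))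
  have hbot : Tendsto s atBot atBot :=
    tendsto_atBot_mono' atBot ((eventually_le_atBot 0).mono fun t ht => by
      have h0t : s t - c * t ≤ s 0 - c * 0 := hlin ht
      change s t ≤ s 0 + c * t
      linarith) (tendsto_atBot_add_const_left _ _ (tendsto_id.const_mul_atBot hc))
  set e := hmono.orderIsoOfSurjective s (hcont.surjective htop hbot)
  exact ⟨e.symm, e.symm.monotone, e.symm_apply_apply, fun x =>
    HasDerivAt.of_local_left_inverse e.symm.continuous.continuousAt (hs _)
      (hc.trans_le (hle _)).ne' (Eventually.of_forall e.apply_symm_apply)⟩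

theorem exists_isIntegralCurveOn_timeChange {E : Type*} [NormedAddCommGroup E] [NormedSpace ℝ E]
    {f : E → E} {g : E → ℝ} {y : ℝ → E}
    (hy : IsIntegralCurveOn y (fun _ x => g x • f x) (Ici 0))
    (hg : Continuous g) {c : ℝ} (hc : 0 < c) (hle : ∀ t, 0 ≤ t → c ≤ g (y t)) :
    ∃ w : ℝ → E, w 0 = y 0 ∧ IsIntegralCurveOn w (fun _ => f) (Ici 0) ∧
      ∀ s, 0 ≤ s → w s ∈ y '' Ici 0 := by
  have hcont : Continuous fun t => g (y (max t 0)) :=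
    hg.comp (hy.continuousOn.comp_continuous (by fun_prop) fun t => le_max_right t 0)
  have hgc : ∀ t, c ≤ g (y (max t 0)) := fun t => hle _ (le_max_right t 0)
  obtain ⟨σ, hσmono, hσ, hσ'⟩ := exists_inverse_of_le_deriv
    (fun t => (hcont.integral_hasStrictDerivAt 0 t).hasDerivAt) hc hgc
  have hσ0 : σ 0 = 0 := by simpa using hσ 0
  have hσ_nonneg : ∀ s, 0 ≤ s → 0 ≤ σ s := fun s hs => hσ0 ▸ hσmono hs
  refine ⟨y ∘ σ, by rw [Function.comp_apply, hσ0], fun s hs => ?_,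
    fun s hs => ⟨σ s, hσ_nonneg s hs, rfl⟩⟩
  refine ((hy (σ s) (hσ_nonneg s hs)).scomp s (hσ' s).hasDerivWithinAt
    hσ_nonneg).congr_deriv ?_
  have hpos := hc.trans_le (hgc (σ s))
  rw [max_eq_left (hσ_nonneg s hs)] at hpos ⊢
  rw [smul_smul, inv_mul_cancel₀ hpos.ne', one_smul, Function.comp_apply]

end TimeChange

section Comparison

variable {ι : Type*} [Fintype ι] {μ : ι → ℝ} {ρ : ℝ} {i : ι} {y : ℝ → ι → ℝ} {a a' : ℝ}

/-- The plane of logarithmic coordinates that contains the trajectory from the constant vector `a`: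
`s` is time measured by the integral of the gain, and `r` is the integral of the inverse center with
respect to `s`. -/
def planar (μ : ι → ℝ) (a s r : ℝ) : ι → ℝ := fun j => a + μ j * s - μ j ^ 2 * r

theorem logMoment_add_const (μ : ι → ℝ) (n : ℕ) (y : ι → ℝ) (l : ℝ) :
    logMoment μ n (fun j => y j + l) = Real.exp l ^ 2 * logMoment μ n y := by
  rw [logMoment, logMoment, Finset.mul_sum]
  refine Finset.sum_congr rfl fun j _ => ?_
  rw [mul_add, Real.exp_add, mul_comm 2 l, Real.exp_mul l 2, Real.rpow_two]
  ring

theorem logCenter_add_const (μ : ι → ℝ) (ρ : ℝ) (y : ι → ℝ) (l : ℝ) :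
    logCenter μ ρ (fun j => y j + l) = Real.exp l * logCenter μ ρ y := by
  rw [logCenter, logMoment_add_const, mul_left_comm, Real.sqrt_mul (sq_nonneg _),
    Real.sqrt_sq (Real.exp_pos l).le, mul_div_assoc, logCenter]

theorem logCenter_mono (μ : ι → ℝ) (hρ : 0 < ρ) : Monotone (logCenter μ ρ) := fun y z hyz => by
  unfold logCenter logMoment
  gcongr with j
  exact hyz j

theorem logCenter_planar_le (μ : ι → ℝ) (hρ : 0 < ρ) {s r r' : ℝ} (hr : r' ≤ r) :
    logCenter μ ρ (planar μ a s r) ≤ Real.exp (a - a') * logCenter μ ρ (planar μ a' s r') := by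
  rw [← logCenter_add_const]
  refine logCenter_mono μ hρ fun j => ?_
  have hj : μ j ^ 2 * r' ≤ μ j ^ 2 * r := by gcongr
  simp only [planar]
  linarith

theorem mul_exp_le_logCenter (μ : ι → ℝ) (hρ : 0 < ρ) (y : ι → ℝ) (j : ι) :
    μ j * Real.exp (y j) ≤ 2 * ρ * logCenter μ ρ y := by
  have hj : (μ j * Real.exp (y j)) ^ 2 ≤ 2 * logMoment μ 2 y := by
    have hle := Finset.single_le_sum (f := fun j => μ j ^ 2 * Real.exp (2 * y j))
      (fun _ _ => by positivity) (Finset.mem_univ j)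
    rw [mul_pow, ← Real.exp_nat_mul, Nat.cast_ofNat]
    have hpos : 0 ≤ μ j ^ 2 * Real.exp (2 * y j) := by positivity
    change _ ≤ logMoment μ 2 y at hle
    linarith
  rw [logCenter, mul_div_cancel₀ _ (by positivity)]
  exact Real.le_sqrt_of_sq_le hj

theorem IsLeastFeature.exists_lt_logCenter_planar (hi : IsLeastFeature μ i) (hρ : 0 < ρ)
    {r : ℝ → ℝ} (hr0 : r 0 = 0)
    (hr : ∀ s ∈ Ici 0, HasDerivWithinAt r (invCenter μ ρ (planar μ a s (r s))) (Ici 0) s)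
    {q : ℝ} (hq : q < 1) (hinv : ∀ s, 0 ≤ s → invCenter μ ρ (planar μ a s (r s)) ≤ q / μ i)
    (B : ℝ) : ∃ s, 0 ≤ s ∧ B < logCenter μ ρ (planar μ a s (r s)) := by
  have hanti : AntitoneOn (fun s => r s - q / μ i * s) (Ici 0) := by
    refine antitoneOn_of_hasDerivWithinAt_nonpos (convex_Ici 0)
      (fun s hs => ((hr s hs).continuousWithinAt).sub (by fun_prop))
      (fun s hs => ((hr s (interior_subset hs)).mono interior_subset).fun_sub
        ((hasDerivWithinAt_id s _).const_mul (q / μ i)))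
      fun s hs => ?_
    rw [mul_one, sub_nonpos]
    exact hinv s (interior_subset hs)
  have hgrowth : ∀ s, 0 ≤ s → a + μ i * (1 - q) * s ≤ planar μ a s (r s) i := fun s hs => by
    have hle : r s - q / μ i * s ≤ 0 := by simpa [hr0] using hanti (mem_Ici.2 le_rfl) hs hs
    have hr_le : μ i ^ 2 * (r s - q / μ i * s) ≤ 0 :=
      mul_nonpos_of_nonneg_of_nonpos (sq_nonneg _) hle
    have hcancel : μ i ^ 2 * (r s - q / μ i * s) = μ i ^ 2 * r s - μ i * q * s := by
      have := hi.pos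
      field_simp
    rw [planar]
    linarith
  have hslope : 0 < μ i * (μ i * (1 - q)) := mul_pos hi.pos (mul_pos hi.pos (sub_pos.2 hq))
  obtain ⟨s, hs, hs0⟩ := (((tendsto_id.const_mul_atTop hslope).eventually_gt_atTop
    (2 * ρ * B - μ i * a)).and (eventually_ge_atTop 0)).exists
  refine ⟨s, hs0, lt_of_mul_lt_mul_left (a := 2 * ρ) ?_ (by positivity)⟩
  calc 2 * ρ * B < μ i * (a + μ i * (1 - q) * s) := by rw [id_eq] at hs; linarith
    _ ≤ μ i * Real.exp (planar μ a s (r s) i) := by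
        have := hi.pos
        gcongr
        linarith [hgrowth s hs0, Real.add_one_le_exp (planar μ a s (r s) i)]
    _ ≤ 2 * ρ * logCenter μ ρ (planar μ a s (r s)) := mul_exp_le_logCenter μ hρ _ i

variable [Nonempty ι]

theorem exists_planar (hμ : ∀ j, 0 < μ j) (hρ : 0 < ρ)
    (hy : IsIntegralCurveOn y (fun _ => samField μ ρ) (Ici 0)) (hy0 : y 0 = fun _ => a) {B : ℝ}
    (hB : ∀ t, 0 ≤ t → logCenter μ ρ (y t) ≤ B) :
    ∃ r : ℝ → ℝ, r 0 = 0 ∧ (∀ s, 0 ≤ s → planar μ a s (r s) ∈ y '' Ici 0) ∧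
      ∀ s ∈ Ici 0, HasDerivWithinAt r (invCenter μ ρ (planar μ a s (r s))) (Ici 0) s := by
  obtain ⟨c, hc, hgain⟩ := exists_le_gain hμ hρ B
  obtain ⟨w, hw0, hw, hmem⟩ := exists_isIntegralCurveOn_timeChange (g := gain μ ρ)
    (f := fun x j => μ j * (1 - μ j * invCenter μ ρ x)) hy (contDiff_gain hμ hρ).continuous hc
    fun t ht => hgain _ (hB t ht)
  have hcont : Continuous fun s => invCenter μ ρ (w (max s 0)) :=
    (contDiff_invCenter hμ hρ).continuous.comp
      (hw.continuousOn.comp_continuous (by fun_prop) fun s => le_max_right s 0)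
  set r : ℝ → ℝ := fun s => ∫ u in (0 : ℝ)..s, invCenter μ ρ (w (max u 0)) with hr
  have hr' : ∀ s ∈ Ici 0, HasDerivWithinAt r (invCenter μ ρ (w s)) (Ici 0) s := fun s hs => by
    simpa only [max_eq_left (mem_Ici.1 hs)] using
      (hcont.integral_hasStrictDerivAt 0 s).hasDerivAt.hasDerivWithinAt (s := Ici 0)
  have hplanar : ∀ s ∈ Ici 0, w s = planar μ a s (r s) := fun s hs => funext fun j => by
    have hconst : ∀ u ∈ Ici 0, HasDerivWithinAt
        (fun u => w u j - planar μ a u (r u) j) 0 (Ici 0) u := fun u hu =>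
      ((hasDerivWithinAt_pi.1 (hw u hu) j).fun_sub ((((hasDerivWithinAt_id u _).const_mul
        (μ j)).const_add a).fun_sub ((hr' u hu).const_mul (μ j ^ 2)))).congr_deriv (by ring)
    have h := (convex_Ici (0 : ℝ)).norm_image_sub_le_of_norm_hasDerivWithin_le (C := 0) hconst
      (fun _ _ => norm_zero.le) (mem_Ici.2 le_rfl) hs
    simpa [planar, hw0, hy0, hr, sub_eq_zero] using h
  refine ⟨r, intervalIntegral.integral_same, fun s hs => hplanar s hs ▸ hmem s hs,
    fun s hs => hplanar s hs ▸ hr' s hs⟩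

theorem planar_coord_le_of_start_lt (hμ : ∀ j, 0 < μ j) (hρ : 0 < ρ) (haa' : a < a') {r r' : ℝ → ℝ}
    (hr : ∀ s ∈ Ici 0, HasDerivWithinAt r (invCenter μ ρ (planar μ a s (r s))) (Ici 0) s)
    (hr' : ∀ s ∈ Ici 0, HasDerivWithinAt r' (invCenter μ ρ (planar μ a' s (r' s))) (Ici 0) s)
    (h0 : r' 0 ≤ r 0) {s : ℝ} (hs : 0 ≤ s) : r' s ≤ r s := by
  rcases hs.eq_or_lt with rfl | hs
  · exact h0
  refine (sub_pos.1 (pos_of_nonneg_of_deriv_pos_of_eq_zero ordConnected_Ici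
    (f := fun u => r u - r' u) (fun u hu => (hr u hu).fun_sub (hr' u hu)) (fun u _ hzero => ?_)
    (mem_Ici.2 le_rfl) (mem_Ici.2 hs.le) hs (sub_nonneg.2 h0))).le
  have hle := logCenter_planar_le μ hρ (a := a) (a' := a') (s := u) (sub_eq_zero.1 hzero).ge
  have hc := logCenter_pos hμ hρ (planar μ a u (r u))
  have hc' := logCenter_pos hμ hρ (planar μ a' u (r' u))
  have hexp : Real.exp (a - a') < 1 := Real.exp_lt_one_iff.2 (sub_neg.2 haa')
  rw [sub_pos]
  unfold invCenter
  gcongr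
  nlinarith

/- Started from `a' > a`, the trajectory would have a center larger than that of the trajectory from
`a` by the factor `exp (a' - a)` at equal `s`. Its center would then stay away from the floor, which
forces the weight of the least feature to grow without bound. -/
theorem IsLeastFeature.le_of_floor_le_of_bounded (hi : IsLeastFeature μ i) (hρ : 0 < ρ)
    {y' : ℝ → ι → ℝ} {B : ℝ} (hy : IsIntegralCurveOn y (fun _ => samField μ ρ) (Ici 0))
    (hy0 : y 0 = fun _ => a) (hfloor : ∀ t, 0 ≤ t → μ i / 2 ≤ logCenter μ ρ (y t))
    (hB : ∀ t, 0 ≤ t → logCenter μ ρ (y t) ≤ B)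
    (hy' : IsIntegralCurveOn y' (fun _ => samField μ ρ) (Ici 0)) (hy0' : y' 0 = fun _ => a')
    (hB' : ∀ t, 0 ≤ t → logCenter μ ρ (y' t) ≤ B) : a' ≤ a := by
  by_contra! haa'
  obtain ⟨r, hr0, hmem, hr⟩ := exists_planar hi.all_pos hρ hy hy0 hB
  obtain ⟨r', hr0', hmem', hr'⟩ := exists_planar hi.all_pos hρ hy' hy0' hB'
  have hinv : ∀ s, 0 ≤ s → invCenter μ ρ (planar μ a' s (r' s)) ≤ Real.exp (a - a') / μ i := by
    intro s hs
    obtain ⟨t, ht, hts⟩ := hmem s hs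
    have hle := (hfloor t ht).trans (hts ▸ logCenter_planar_le μ hρ (a' := a')
      (planar_coord_le_of_start_lt hi.all_pos hρ haa' hr hr' (by rw [hr0, hr0']) hs))
    rw [invCenter, ← one_div, div_le_div_iff₀
      (mul_pos two_pos (logCenter_pos hi.all_pos hρ _)) hi.pos]
    linarith
  obtain ⟨s, hs, hlt⟩ := hi.exists_lt_logCenter_planar hρ hr0' hr'
    (Real.exp_lt_one_iff.2 (sub_neg.2 haa')) hinv B
  obtain ⟨t, ht, hts⟩ := hmem' s hs
  exact (hB' t ht).not_gt (hts ▸ hlt)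

end Comparison

section Dichotomy

variable {ι : Type*} [Fintype ι] {μ : ι → ℝ} {ρ : ℝ} {i : ι} {S : Set ℝ} {y : ℝ → ι → ℝ} {a : ℝ}
  {x₀ : ι → ℝ} {T : EReal}

/-- The region of logarithmic coordinates where the center is below the floor `μ i / 2`. -/
def belowFloor (μ : ι → ℝ) (ρ : ℝ) (i : ι) : Set (ι → ℝ) := {x | logCenter μ ρ x < μ i / 2}

/-- The region of logarithmic coordinates where the center is above the ceiling. -/
def aboveCeiling (μ : ι → ℝ) (ρ : ℝ) : Set (ι → ℝ) := {x | logCeiling μ x < logCenter μ ρ x}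

theorem logCenter_const (μ : ι → ℝ) (ρ a : ℝ) :
    logCenter μ ρ (fun _ => a) = Real.exp a * logCenter μ ρ 0 := by
  simpa using logCenter_add_const μ ρ 0 a

variable [Nonempty ι]

theorem isOpen_belowFloor (hμ : ∀ j, 0 < μ j) (ρ : ℝ) (i : ι) : IsOpen (belowFloor μ ρ i) :=
  isOpen_lt (contDiff_logCenter hμ ρ).continuous continuous_const

theorem isOpen_aboveCeiling (hμ : ∀ j, 0 < μ j) (ρ : ℝ) : IsOpen (aboveCeiling μ ρ) :=
  isOpen_lt (continuous_logCeiling hμ) (contDiff_logCenter hμ ρ).continuous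

theorem IsLeastFeature.floor_lt_logCenter_of_not_visits (hi : IsLeastFeature μ i) (hρ : 0 < ρ)
    (hy : IsMaximalSolution (samField μ ρ) x₀ T y)
    (h : ¬Visits (samField μ ρ) (belowFloor μ ρ i) x₀) {t : ℝ} (ht : t ∈ lifespan T) :
    μ i / 2 < logCenter μ ρ (y t) := by
  obtain ⟨s, hs, hts⟩ := exists_lt_mem_lifespan ht
  exact not_le.1 fun hle => h ⟨T, y, hy, s, hs, hi.center_lt_floor hρ (ordConnected_lifespan T)
    hy.isIntegralCurveOn ht hs hts hle⟩

theorem IsLeastFeature.logCenter_lt_logCeiling_of_not_visits (hi : IsLeastFeature μ i)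
    (hρ : 0 < ρ) (hy : IsMaximalSolution (samField μ ρ) x₀ T y)
    (h : ¬Visits (samField μ ρ) (aboveCeiling μ ρ) x₀) {t : ℝ} (ht : t ∈ lifespan T) :
    logCenter μ ρ (y t) < logCeiling μ (y t) := by
  obtain ⟨s, hs, hts⟩ := exists_lt_mem_lifespan ht
  exact not_le.1 fun hle => h ⟨T, y, hy, s, hs, hi.ceiling_lt_center hρ (ordConnected_lifespan T)
    hy.isIntegralCurveOn ht hs hts hle⟩

theorem IsLeastFeature.visits_belowFloor (hi : IsLeastFeature μ i) (hρ : 0 < ρ)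
    (h : logCenter μ ρ x₀ ≤ μ i / 2) : Visits (samField μ ρ) (belowFloor μ ρ i) x₀ := by
  by_contra hv
  obtain ⟨T, y, hy⟩ :=
    exists_isMaximalSolution (contDiff_samField hi.all_pos hρ).locallyLipschitz x₀
  exact (hi.floor_lt_logCenter_of_not_visits hρ hy hv (zero_mem_lifespan hy.pos)).not_ge
    (hy.start ▸ h)

theorem IsLeastFeature.visits_aboveCeiling (hi : IsLeastFeature μ i) (hρ : 0 < ρ)
    (h : logCeiling μ x₀ ≤ logCenter μ ρ x₀) :
    Visits (samField μ ρ) (aboveCeiling μ ρ) x₀ := by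
  by_contra hv
  obtain ⟨T, y, hy⟩ :=
    exists_isMaximalSolution (contDiff_samField hi.all_pos hρ).locallyLipschitz x₀
  exact (hi.logCenter_lt_logCeiling_of_not_visits hρ hy hv (zero_mem_lifespan hy.pos)).not_ge
    (hy.start ▸ h)

theorem IsLeastFeature.notMem_aboveCeiling (hi : IsLeastFeature μ i) (hρ : 0 < ρ)
    (hS : S.OrdConnected) (hy : IsIntegralCurveOn y (fun _ => samField μ ρ) S) {s t : ℝ}
    (hs : s ∈ S) (hfloor : y s ∈ belowFloor μ ρ i) (ht : t ∈ S) : y t ∉ aboveCeiling μ ρ := by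
  intro hceil
  rcases lt_trichotomy s t with hst | rfl | hts
  · exact lt_asymm hceil ((hi.center_lt_floor hρ hS hy hs ht hst (le_of_lt hfloor)).trans
      (hi.floor_lt_logCeiling _))
  · exact lt_asymm hceil (hfloor.trans (hi.floor_lt_logCeiling _))
  · exact lt_asymm (hi.ceiling_lt_center hρ hS hy ht hs hts (le_of_lt hceil))
      (hfloor.trans (hi.floor_lt_logCeiling _))

theorem IsLeastFeature.disjoint_visits (hi : IsLeastFeature μ i) (hρ : 0 < ρ) :
    Disjoint {x₀ | Visits (samField μ ρ) (belowFloor μ ρ i) x₀}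
      {x₀ | Visits (samField μ ρ) (aboveCeiling μ ρ) x₀} := by
  refine disjoint_left.2 fun x₀ ⟨T, y, hy, s, hs, hfloor⟩ hvisits => ?_
  obtain ⟨t, ht, hceil⟩ :=
    (hy.visits_iff (contDiff_samField hi.all_pos hρ).locallyLipschitz _).1 hvisits
  exact hi.notMem_aboveCeiling hρ (ordConnected_lifespan T) hy.isIntegralCurveOn hs hfloor ht hceil

theorem IsLeastFeature.eq_top_of_not_visits (hi : IsLeastFeature μ i) (hρ : 0 < ρ)
    (hy : IsMaximalSolution (samField μ ρ) x₀ T y)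
    (hfloor : ¬Visits (samField μ ρ) (belowFloor μ ρ i) x₀) : T = ⊤ :=
  hy.eq_top_of_le_logCenter hi.all_pos hρ (half_pos hi.pos) fun t ht =>
    not_lt.1 fun hlt => hfloor ⟨T, y, hy, t, ht, hlt⟩

theorem IsLeastFeature.le_of_not_visits (hi : IsLeastFeature μ i) (hρ : 0 < ρ) {a a' : ℝ}
    (hfloor : ¬Visits (samField μ ρ) (belowFloor μ ρ i) fun _ => a)
    (hceil : ¬Visits (samField μ ρ) (aboveCeiling μ ρ) fun _ => a)
    (hfloor' : ¬Visits (samField μ ρ) (belowFloor μ ρ i) fun _ => a')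
    (hceil' : ¬Visits (samField μ ρ) (aboveCeiling μ ρ) fun _ => a') : a' ≤ a := by
  have hf := (contDiff_samField hi.all_pos hρ).locallyLipschitz
  obtain ⟨T, y, hy⟩ := exists_isMaximalSolution hf fun _ => a
  obtain ⟨T', y', hy'⟩ := exists_isMaximalSolution hf fun _ => a'
  obtain rfl := hi.eq_top_of_not_visits hρ hy hfloor
  obtain rfl := hi.eq_top_of_not_visits hρ hy' hfloor'
  have hfl := fun t ht => hi.floor_lt_logCenter_of_not_visits hρ hy hfloor (t := t) ht
  have hle := fun t ht => ((hi.logCenter_lt_logCeiling_of_not_visits hρ hy hceil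
    (t := t) ht).le.trans (logCeiling_le hi.all_pos _))
  have hle' := fun t ht => ((hi.logCenter_lt_logCeiling_of_not_visits hρ hy' hceil'
    (t := t) ht).le.trans (logCeiling_le hi.all_pos _))
  have hint := hy.isIntegralCurveOn
  have hint' := hy'.isIntegralCurveOn
  rw [lifespan_top] at hint hint' hfl hle hle'
  exact hi.le_of_floor_le_of_bounded hρ hint hy.start (fun t ht => (hfl t ht).le) hle hint'
    hy'.start hle'

theorem IsLeastFeature.exists_threshold (hi : IsLeastFeature μ i) (hρ : 0 < ρ) :
    ∃ a₁ : ℝ, (∀ a, (Visits (samField μ ρ) (belowFloor μ ρ i) fun _ => a) ↔ a < a₁) ∧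
      ∀ a, (Visits (samField μ ρ) (aboveCeiling μ ρ) fun _ => a) ↔ a₁ < a := by
  have hf := (contDiff_samField hi.all_pos hρ).locallyLipschitz
  have hconst : Continuous fun (a : ℝ) (_ : ι) => a := by fun_prop
  have hbot : ∀ᶠ a in atBot, Visits (samField μ ρ) (belowFloor μ ρ i) fun _ => a := by
    filter_upwards [(Real.tendsto_exp_atBot.mul_const (logCenter μ ρ 0)).eventually_le_const
      (u := μ i / 2) (by rw [zero_mul]; exact half_pos hi.pos)] with a ha
    exact hi.visits_belowFloor hρ ((logCenter_const μ ρ a).trans_le ha)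
  have htop : ∀ᶠ a in atTop, Visits (samField μ ρ) (aboveCeiling μ ρ) fun _ => a := by
    filter_upwards [(Real.tendsto_exp_atTop.atTop_mul_const
      (logCenter_pos hi.all_pos hρ 0)).eventually_ge_atTop (‖μ‖ / 2)] with a ha
    exact hi.visits_aboveCeiling hρ
      ((logCeiling_le hi.all_pos _).trans (ha.trans (logCenter_const μ ρ a).ge))
  obtain ⟨a₁, hfloor, hceil⟩ := exists_eq_Iio_Ioi
    ((isOpen_setOf_visits hf (isOpen_belowFloor hi.all_pos ρ i)).preimage hconst)
    ((isOpen_setOf_visits hf (isOpen_aboveCeiling hi.all_pos ρ)).preimage hconst)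
    ((hi.disjoint_visits hρ).preimage _) (fun a ha a' ha' => le_antisymm
      (hi.le_of_not_visits hρ (not_or.1 ha').1 (not_or.1 ha').2 (not_or.1 ha).1 (not_or.1 ha).2)
      (hi.le_of_not_visits hρ (not_or.1 ha).1 (not_or.1 ha).2 (not_or.1 ha').1 (not_or.1 ha').2))
    hbot htop
  exact ⟨a₁, fun a => Set.ext_iff.1 hfloor a, fun a => Set.ext_iff.1 hceil a⟩

end Dichotomy

section Gradient

variable {d : ℕ} {μ : Fin d → ℝ} {ρ : ℝ} {θ : Params d}

/-- The factor `-ℓ'(⟨β, μ⟩)` in the gradient of the loss, where `ℓ` is the logistic loss. -/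
def lossSlope (μ : Fin d → ℝ) (θ : Params d) : ℝ := (1 + Real.exp (margin μ θ))⁻¹

theorem lossSlope_pos (μ : Fin d → ℝ) (θ : Params d) : 0 < lossSlope μ θ := by
  unfold lossSlope
  positivity

theorem continuous_margin (μ : Fin d → ℝ) : Continuous (margin μ) := by
  unfold margin beta
  fun_prop

theorem continuous_lossSlope (μ : Fin d → ℝ) : Continuous (lossSlope μ) :=
  (continuous_const.add (continuous_margin μ).rexp).inv₀
    fun _ => (add_pos one_pos (Real.exp_pos _)).ne'

theorem continuous_nTheta (μ : Fin d → ℝ) : Continuous (nTheta μ) := by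
  unfold nTheta
  fun_prop

theorem hasDerivAt_logistic (s : ℝ) : HasDerivAt logistic (-(1 + Real.exp s)⁻¹) s := by
  have h : HasDerivAt logistic _ s :=
    (((hasDerivAt_neg s).exp).const_add 1).log (by positivity)
  refine h.congr_deriv ?_
  rw [Real.exp_neg]
  have := Real.exp_pos s
  field_simp
  ring

theorem gradient_loss_apply (μ : Fin d → ℝ) (θ : Params d) (p : Fin 2 × Fin d) :
    (∇ (loss μ) θ) p = -lossSlope μ θ * (μ p.2 * θ (1 - p.1, p.2)) := by
  suffices HasGradientAt (loss μ)
      (WithLp.toLp 2 fun p => -lossSlope μ θ * (μ p.2 * θ (1 - p.1, p.2))) θ by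
    rw [this.gradient]
  have hproj : ∀ p, HasFDerivAt (fun θ : Params d => θ p)
      (EuclideanSpace.proj p : Params d →L[ℝ] ℝ) θ :=
    fun p => (EuclideanSpace.proj p : Params d →L[ℝ] ℝ).hasFDerivAt
  have hmargin : HasFDerivAt (margin μ) _ θ := HasFDerivAt.fun_sum (u := Finset.univ)
    fun j _ => ((hproj (0, j)).mul (hproj (1, j))).mul_const (μ j)
  refine hasGradientAt_iff_hasFDerivAt.2 (HasFDerivAt.congr_fderiv
    ((hasDerivAt_logistic (margin μ θ)).comp_hasFDerivAt θ hmargin) ?_)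
  ext v
  simp only [smul_add, neg_smul, neg_apply, smul_apply, sum_apply, add_apply, PiLp.proj_apply,
    smul_eq_mul, Finset.mul_sum, lossSlope, neg_mul, InnerProductSpace.toDual_apply_apply,
    PiLp.inner_apply, RCLike.inner_apply, Real.ringHom_apply, mul_neg, Finset.sum_neg_distrib,
    Fintype.sum_prod_type, Fin.sum_univ_two, sub_zero, sub_self, ← Finset.sum_add_distrib, neg_inj]
  exact Finset.sum_congr rfl fun j _ => by ring

theorem continuous_gradient_loss (μ : Fin d → ℝ) : Continuous (∇ (loss μ)) := by
  have hslope := continuous_lossSlope μ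
  have hgrad : ∇ (loss μ) = fun θ : Params d => WithLp.toLp 2 fun p : Fin 2 × Fin d =>
      -lossSlope μ θ * (μ p.2 * θ (1 - p.1, p.2)) :=
    funext fun θ => PiLp.ext (gradient_loss_apply μ θ)
  rw [hgrad]
  fun_prop

theorem norm_gradient_loss (μ : Fin d → ℝ) (θ : Params d) :
    ‖∇ (loss μ) θ‖ = lossSlope μ θ * nTheta μ θ := by
  rw [EuclideanSpace.norm_eq, nTheta, ← Real.sqrt_sq (lossSlope_pos μ θ).le,
    ← Real.sqrt_mul (sq_nonneg _)]
  congr 1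
  simp only [gradient_loss_apply, Fintype.sum_prod_type, Fin.sum_univ_two, Finset.mul_sum,
    ← Finset.sum_add_distrib, Real.norm_eq_abs, sq_abs, sub_zero, sub_self]
  exact Finset.sum_congr rfl fun j _ => by ring

theorem gradient_loss_ne_zero_iff : ∇ (loss μ) θ ≠ 0 ↔ 0 < nTheta μ θ := by
  rw [← norm_pos_iff, norm_gradient_loss, mul_pos_iff_of_pos_left (lossSlope_pos μ θ)]

theorem perturbed_apply (h : 0 < nTheta μ θ) (p : Fin 2 × Fin d) :
    perturbed μ ρ θ p = θ p - ρ / nTheta μ θ * (μ p.2 * θ (1 - p.1, p.2)) := by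
  have hslope := lossSlope_pos μ θ
  rw [perturbed, norm_gradient_loss, PiLp.add_apply, PiLp.smul_apply, gradient_loss_apply,
    smul_eq_mul]
  field_simp
  ring

theorem continuousOn_perturbed (μ : Fin d → ℝ) (ρ : ℝ) :
    ContinuousOn (perturbed μ ρ) {θ | ∇ (loss μ) θ ≠ 0} :=
  continuousOn_id.add ((continuousOn_const.div (continuous_gradient_loss μ).norm.continuousOn
    fun _ h => norm_ne_zero_iff.2 h).smul (continuous_gradient_loss μ).continuousOn)

theorem neg_gradient_perturbed_apply (h : 0 < nTheta μ θ) (p : Fin 2 × Fin d) :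
    (-∇ (loss μ) (perturbed μ ρ θ)) p = lossSlope μ (perturbed μ ρ θ) *
      (μ p.2 * (θ (1 - p.1, p.2) - ρ / nTheta μ θ * (μ p.2 * θ p))) := by
  rw [PiLp.neg_apply, gradient_loss_apply, perturbed_apply h, sub_sub_cancel, neg_mul, neg_neg]

end Gradient

section ExpParam

variable {d : ℕ}

/-- The parameter with both layers equal to `exp (y j)`. The SAM flow from `α 𝟏` consists of such
parameters. -/
def expParam (y : Fin d → ℝ) : Params d := WithLp.toLp 2 fun p => Real.exp (y p.2)

theorem expParam_apply (y : Fin d → ℝ) (p : Fin 2 × Fin d) : expParam y p = Real.exp (y p.2) := rfl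

theorem beta_expParam (y : Fin d → ℝ) (j : Fin d) : beta (expParam y) j = Real.exp (2 * y j) := by
  rw [beta, expParam_apply, expParam_apply, ← Real.exp_add, two_mul]

theorem nTheta_expParam (μ : Fin d → ℝ) (y : Fin d → ℝ) :
    nTheta μ (expParam y) = Real.sqrt (2 * logMoment μ 2 y) := by
  rw [nTheta, logMoment, Finset.mul_sum]
  congr 1
  refine Finset.sum_congr rfl fun j _ => ?_
  rw [expParam_apply, expParam_apply, two_mul (y j), Real.exp_add]
  ring

theorem mc_expParam (μ : Fin d → ℝ) (ρ : ℝ) (y : Fin d → ℝ) :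
    mc μ ρ (expParam y) = logCenter μ ρ y := by
  rw [mc, nTheta_expParam, logCenter]

theorem moment_expParam (μ : Fin d → ℝ) (r : ℕ) (y : Fin d → ℝ) :
    moment μ r (expParam y) = logMoment μ (r + 2) y / logMoment μ 2 y := by
  simp only [moment, prop, beta_expParam, logMoment, Finset.sum_div]
  exact Finset.sum_congr rfl fun j _ => by ring

variable {μ : Fin d → ℝ} {ρ : ℝ}

theorem div_nTheta_expParam (μ : Fin d → ℝ) (hρ : 0 < ρ) (y : Fin d → ℝ) :
    ρ / nTheta μ (expParam y) = invCenter μ ρ y := by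
  rw [nTheta_expParam, invCenter, logCenter]
  field_simp

variable [Nonempty (Fin d)]

theorem mH_expParam (hμ : ∀ j, 0 < μ j) (y : Fin d → ℝ) :
    mH μ (expParam y) = logCeiling μ y := by
  have h2 := logMoment_pos hμ 2 y
  have h3 := logMoment_pos hμ 3 y
  rw [mH, moment_expParam, moment_expParam, logCeiling]
  field_simp

theorem nTheta_expParam_pos (hμ : ∀ j, 0 < μ j) (y : Fin d → ℝ) : 0 < nTheta μ (expParam y) := by
  have h2 := logMoment_pos hμ 2 y
  rw [nTheta_expParam]
  positivity

theorem lossSlope_perturbed_expParam (hμ : ∀ j, 0 < μ j) (hρ : 0 < ρ) (y : Fin d → ℝ) :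
    lossSlope μ (perturbed μ ρ (expParam y)) = gain μ ρ y := by
  rw [lossSlope, gain, logMargin, margin]
  congr 3
  refine Finset.sum_congr rfl fun j _ => ?_
  simp only [beta, perturbed_apply (nTheta_expParam_pos hμ y), div_nTheta_expParam μ hρ,
    expParam_apply, two_mul (y j), Real.exp_add]
  ring

theorem neg_gradient_perturbed_expParam (hμ : ∀ j, 0 < μ j) (hρ : 0 < ρ) (y : Fin d → ℝ)
    (p : Fin 2 × Fin d) : (-∇ (loss μ) (perturbed μ ρ (expParam y))) p =
      Real.exp (y p.2) * samField μ ρ y p.2 := by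
  rw [neg_gradient_perturbed_apply (nTheta_expParam_pos hμ y), lossSlope_perturbed_expParam hμ hρ,
    div_nTheta_expParam μ hρ, samField, expParam_apply, expParam_apply]
  ring

end ExpParam

section Flow

variable {d : ℕ} {μ : Fin d → ℝ} {ρ α : ℝ} {T : EReal} {θ : ℝ → Params d} {y : ℝ → Fin d → ℝ}

theorem hasDerivWithinAt_params {θ' : Params d} {S : Set ℝ} {t : ℝ} :
    HasDerivWithinAt θ θ' S t ↔ ∀ p, HasDerivWithinAt (fun t => θ t p) (θ' p) S t := by
  rw [hasDerivWithinAt_iff_hasFDerivWithinAt, hasFDerivWithinAt_euclidean]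
  refine forall_congr' fun p => ?_
  rw [hasDerivWithinAt_iff_hasFDerivWithinAt]
  have e : PiLp.proj 2 (fun _ => ℝ) p ∘L (ContinuousLinearMap.toSpanSingleton ℝ θ') =
      ContinuousLinearMap.toSpanSingleton ℝ (θ' p) := by
    ext; simp
  rw [e]

theorem IsFlow.nTheta_pos (h : IsFlow μ ρ α T θ) {t : ℝ} (ht : t ∈ lifespan T) :
    0 < nTheta μ (θ t) :=
  gradient_loss_ne_zero_iff.1 (h.grad_ne_zero t ht)

theorem IsFlow.continuousOn (h : IsFlow μ ρ α T θ) : ContinuousOn θ (lifespan T) :=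
  fun t ht => ((hasDerivWithinAt_lifespan_iff ht).2 (h.deriv t ht)).continuousWithinAt

theorem IsFlow.hasDerivWithinAt_apply (h : IsFlow μ ρ α T θ) {t : ℝ} (ht : t ∈ lifespan T)
    (p : Fin 2 × Fin d) :
    HasDerivWithinAt (fun s => θ s p) (lossSlope μ (perturbed μ ρ (θ t)) *
      (μ p.2 * (θ t (1 - p.1, p.2) - ρ / nTheta μ (θ t) * (μ p.2 * θ t p)))) (Ici 0) t := by
  rw [← neg_gradient_perturbed_apply (h.nTheta_pos ht)]
  exact hasDerivWithinAt_params.1 (h.deriv t ht) p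

/- The layers enter the flow symmetrically, so that their sum and their difference each solve a
homogeneous linear equation. -/
theorem IsFlow.hasDerivWithinAt_layer_combination (h : IsFlow μ ρ α T θ) {ε : ℝ}
    (hε : ε ^ 2 = 1) {t : ℝ} (ht : t ∈ lifespan T) (j : Fin d) :
    HasDerivWithinAt (fun s => θ s (0, j) + ε * θ s (1, j))
      (lossSlope μ (perturbed μ ρ (θ t)) * (μ j * (ε - ρ / nTheta μ (θ t) * μ j)) *
        (θ t (0, j) + ε * θ t (1, j))) (Ici 0) t := by
  have hfirst := h.hasDerivWithinAt_apply ht (0, j)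
  have hsecond := h.hasDerivWithinAt_apply ht (1, j)
  refine (hfirst.fun_add (hsecond.const_mul ε)).congr_deriv ?_
  simp only [sub_zero, sub_self]
  linear_combination -lossSlope μ (perturbed μ ρ (θ t)) * μ j * θ t (1, j) * hε

theorem IsFlow.layer_combination (h : IsFlow μ ρ α T θ) {ε : ℝ} (hε : ε ^ 2 = 1) {t : ℝ}
    (ht : t ∈ lifespan T) (j : Fin d) :
    ∃ l, θ t (0, j) + ε * θ t (1, j) = (1 + ε) * α * Real.exp l := by
  have hsub := Icc_subset_lifespan ht
  have hcont : ContinuousOn (fun t => lossSlope μ (perturbed μ ρ (θ t)) *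
      (μ j * (ε - ρ / nTheta μ (θ t) * μ j))) (lifespan T) := by
    have hslope := (continuous_lossSlope μ).comp_continuousOn
      ((continuousOn_perturbed μ ρ).comp h.continuousOn h.grad_ne_zero)
    have hratio : ContinuousOn (fun t => ρ / nTheta μ (θ t)) (lifespan T) :=
      continuousOn_const.div ((continuous_nTheta μ).comp_continuousOn h.continuousOn)
        fun t ht => (h.nTheta_pos ht).ne'
    exact hslope.mul (continuousOn_const.mul
      (continuousOn_const.sub (hratio.mul continuousOn_const)))
  obtain ⟨l, hl⟩ := exists_eq_mul_exp_of_linear ht.1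
    (fun s hs => (h.hasDerivWithinAt_layer_combination hε (hsub hs) j).mono Icc_subset_Ici_self)
    (hcont.mono hsub)
  rw [h.init, h.init] at hl
  exact ⟨l, by rw [hl]; ring⟩

theorem IsFlow.pos_and_layer_eq (h : IsFlow μ ρ α T θ) (hα : 0 < α) {t : ℝ}
    (ht : t ∈ lifespan T) (j : Fin d) : 0 < θ t (0, j) ∧ θ t (1, j) = θ t (0, j) := by
  obtain ⟨l, hsum⟩ := h.layer_combination (ε := 1) (by norm_num) ht j
  obtain ⟨l', hdiff⟩ := h.layer_combination (ε := -1) (by norm_num) ht j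
  have hpos : 0 < (1 + 1) * α * Real.exp l := by positivity
  rw [add_neg_cancel, zero_mul, zero_mul] at hdiff
  constructor <;> linarith

theorem IsFlow.eq_expParam (h : IsFlow μ ρ α T θ) (hα : 0 < α) {t : ℝ} (ht : t ∈ lifespan T) :
    θ t = expParam fun j => Real.log (θ t (0, j)) := by
  ext ⟨l, j⟩
  obtain ⟨hpos, heq⟩ := h.pos_and_layer_eq hα ht j
  rw [expParam_apply, Real.exp_log hpos]
  fin_cases l
  exacts [rfl, heq]

variable [Nonempty (Fin d)]

theorem IsFlow.isIntegralCurveOn_log (hμ : ∀ j, 0 < μ j) (hρ : 0 < ρ) (hα : 0 < α)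
    (h : IsFlow μ ρ α T θ) :
    IsIntegralCurveOn (fun t j => Real.log (θ t (0, j))) (fun _ => samField μ ρ) (lifespan T) :=
  fun t ht => hasDerivWithinAt_pi.2 fun j => by
    have hpos := (h.pos_and_layer_eq hα ht j).1
    have hderiv := hasDerivWithinAt_params.1 (h.deriv t ht) (0, j)
    rw [h.eq_expParam hα ht, neg_gradient_perturbed_expParam hμ hρ, Real.exp_log hpos] at hderiv
    exact ((((hasDerivWithinAt_lifespan_iff ht).2 hderiv).log hpos.ne').congr_deriv
      (mul_div_cancel_left₀ _ hpos.ne'))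

theorem isFlow_expParam (hμ : ∀ j, 0 < μ j) (hρ : 0 < ρ) (hα : 0 < α) (hT : 0 < T)
    (hy : IsIntegralCurveOn y (fun _ => samField μ ρ) (lifespan T))
    (hy0 : y 0 = fun _ => Real.log α) : IsFlow μ ρ α T fun t => expParam (y t) where
  pos := hT
  init p := by rw [expParam_apply, hy0, Real.exp_log hα]
  grad_ne_zero t _ := gradient_loss_ne_zero_iff.2 (nTheta_expParam_pos hμ (y t))
  deriv t ht := hasDerivWithinAt_params.2 fun p => by
    rw [neg_gradient_perturbed_expParam hμ hρ]
    exact (hasDerivWithinAt_pi.1 ((hasDerivWithinAt_lifespan_iff ht).1 (hy t ht)) p.2).exp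

theorem IsMaximalFlow.exists_isMaximalSolution (hμ : ∀ j, 0 < μ j) (hρ : 0 < ρ) (hα : 0 < α)
    (h : IsMaximalFlow μ ρ α T θ) :
    ∃ y, IsMaximalSolution (samField μ ρ) (fun _ => Real.log α) T y ∧
      ∀ t ∈ lifespan T, θ t = expParam (y t) := by
  have hy := h.isIntegralCurveOn_log hμ hρ hα
  have hy0 : (fun j => Real.log (θ 0 (0, j))) = fun _ => Real.log α := by simp only [h.init]
  refine ⟨_, ⟨h.pos, hy0, hy, fun T' z hz0 hz => ?_⟩, fun t ht => h.eq_expParam hα ht⟩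
  by_contra! hlt
  refine hlt.not_ge (h.maximal T' _ (isFlow_expParam hμ hρ hα (h.pos.trans hlt) hz hz0)
    fun t ht => ?_)
  rw [h.eq_expParam hα ht]
  exact congrArg expParam (eqOn_of_isIntegralCurveOn (contDiff_samField hμ hρ).locallyLipschitz
    (hz.mono (lifespan_mono hlt.le)) hy (hz0.trans hy0.symm) ht)

theorem exists_isMaximalFlow (hμ : ∀ j, 0 < μ j) (hρ : 0 < ρ) (hα : 0 < α) :
    ∃ T θ, IsMaximalFlow μ ρ α T θ := by
  obtain ⟨T, y, hy⟩ := exists_isMaximalSolution (contDiff_samField hμ hρ).locallyLipschitz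
    fun _ => Real.log α
  refine ⟨T, _, isFlow_expParam hμ hρ hα hy.pos hy.isIntegralCurveOn hy.start, fun T' θ' h _ => ?_⟩
  exact hy.maximal T' _ (by simp only [h.init]) (h.isIntegralCurveOn_log hμ hρ hα)

end Flow

section Crossings

variable {ι : Type*} [Fintype ι] [Nonempty ι] {μ : ι → ℝ} {ρ : ℝ} {i : ι} {y : ℝ → ι → ℝ}
  {x₀ : ι → ℝ} {T : EReal}

theorem IsLeastFeature.exists_logCenter_eq_floor (hi : IsLeastFeature μ i) (hρ : 0 < ρ)
    (hy : IsMaximalSolution (samField μ ρ) x₀ T y)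
    (hv : Visits (samField μ ρ) (belowFloor μ ρ i) x₀) (h : μ i / 2 ≤ logCenter μ ρ x₀) :
    ∃ t ∈ lifespan T, logCenter μ ρ (y t) = μ i / 2 := by
  obtain ⟨s, hs, hlt⟩ :=
    (hy.visits_iff (contDiff_samField hi.all_pos hρ).locallyLipschitz _).1 hv
  have hcont : ContinuousOn (fun t => logCenter μ ρ (y t)) (Icc 0 s) :=
    (contDiff_logCenter hi.all_pos ρ).continuous.comp_continuousOn
      (hy.isIntegralCurveOn.continuousOn.mono (Icc_subset_lifespan hs))
  obtain ⟨t, ht, heq⟩ := intermediate_value_Icc' hs.1 hcont ⟨le_of_lt hlt, hy.start ▸ h⟩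
  exact ⟨t, Icc_subset_lifespan hs ht, heq⟩

theorem IsLeastFeature.exists_logCenter_eq_logCeiling (hi : IsLeastFeature μ i) (hρ : 0 < ρ)
    (hy : IsMaximalSolution (samField μ ρ) x₀ T y)
    (hv : Visits (samField μ ρ) (aboveCeiling μ ρ) x₀)
    (h : logCenter μ ρ x₀ ≤ logCeiling μ x₀) :
    ∃ tG ∈ lifespan T, logCenter μ ρ (y tG) = logCeiling μ (y tG) ∧
      (∀ t ∈ lifespan T, t < tG → logCenter μ ρ (y t) < logCeiling μ (y t)) ∧
      ∀ t ∈ lifespan T, tG < t → logCeiling μ (y t) < logCenter μ ρ (y t) := by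
  obtain ⟨s, hs, hlt⟩ :=
    (hy.visits_iff (contDiff_samField hi.all_pos hρ).locallyLipschitz _).1 hv
  have hcont : ContinuousOn (fun t => logCenter μ ρ (y t) - logCeiling μ (y t)) (Icc 0 s) :=
    ((contDiff_logCenter hi.all_pos ρ).continuous.sub
      (continuous_logCeiling hi.all_pos)).comp_continuousOn
      (hy.isIntegralCurveOn.continuousOn.mono (Icc_subset_lifespan hs))
  obtain ⟨tG, htG, heq⟩ := intermediate_value_Icc hs.1 hcont
    ⟨sub_nonpos.2 (hy.start ▸ h), (sub_pos.2 hlt).le⟩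
  have htG' := Icc_subset_lifespan hs htG
  rw [sub_eq_zero] at heq
  refine ⟨tG, htG', heq, fun t ht hlt => ?_, fun t ht hlt => ?_⟩
  · exact not_le.1 fun hle => (hi.ceiling_lt_center hρ (ordConnected_lifespan T)
      hy.isIntegralCurveOn ht htG' hlt hle).ne' heq
  · exact hi.ceiling_lt_center hρ (ordConnected_lifespan T) hy.isIntegralCurveOn htG' ht hlt heq.ge

end Crossings

section InitialValues

variable {d : ℕ} {μ : Fin d → ℝ} {ρ α : ℝ}

theorem logMoment_log (μ : Fin d → ℝ) (hα : 0 < α) (n : ℕ) :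
    logMoment μ n (fun _ => Real.log α) = α ^ 2 * ∑ j, μ j ^ n := by
  rw [logMoment, ← Finset.sum_mul, two_mul, Real.exp_add, Real.exp_log hα]
  ring

theorem logCenter_log (μ : Fin d → ℝ) (ρ : ℝ) (hα : 0 < α) :
    logCenter μ ρ (fun _ => Real.log α) = α * (Real.sqrt 2 * norm2 μ) / (2 * ρ) := by
  rw [logCenter, logMoment_log μ hα, norm2, Real.sqrt_mul zero_le_two,
    Real.sqrt_mul (sq_nonneg α), Real.sqrt_sq hα.le]
  ring

theorem logCeiling_log (μ : Fin d → ℝ) (hα : 0 < α) :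
    logCeiling μ (fun _ => Real.log α) = (∑ j, μ j ^ 4) / (∑ j, μ j ^ 3) / 2 := by
  rw [logCeiling, logMoment_log μ hα, logMoment_log μ hα]
  field_simp

theorem alphaH_eq (μ : Fin d → ℝ) (ρ : ℝ) : alphaH μ ρ =
    ρ * ((∑ j, μ j ^ 4) / ∑ j, μ j ^ 3) / (Real.sqrt 2 * norm2 μ) := by
  rw [alphaH, mul_div_assoc', div_div, mul_comm (∑ j, μ j ^ 3)]

variable [Nonempty (Fin d)]

theorem sum_pow_pos (hμ : ∀ j, 0 < μ j) (n : ℕ) : 0 < ∑ j, μ j ^ n :=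
  Finset.sum_pos (fun j _ => pow_pos (hμ j) n) Finset.univ_nonempty

theorem norm2_pos (hμ : ∀ j, 0 < μ j) : 0 < norm2 μ :=
  Real.sqrt_pos.2 (sum_pow_pos hμ 2)

theorem lt_div_norm2_iff (hμ : ∀ j, 0 < μ j) (hρ : 0 < ρ) (hα : 0 < α) (x : ℝ) :
    α < ρ * x / (Real.sqrt 2 * norm2 μ) ↔ logCenter μ ρ (fun _ => Real.log α) < x / 2 := by
  have := norm2_pos hμ
  rw [logCenter_log μ ρ hα, lt_div_iff₀ (by positivity), div_lt_div_iff₀ (by positivity) two_pos]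
  constructor <;> intro h <;> linarith

theorem div_norm2_lt_iff (hμ : ∀ j, 0 < μ j) (hρ : 0 < ρ) (hα : 0 < α) (x : ℝ) :
    ρ * x / (Real.sqrt 2 * norm2 μ) < α ↔ x / 2 < logCenter μ ρ (fun _ => Real.log α) := by
  have := norm2_pos hμ
  rw [logCenter_log μ ρ hα, div_lt_iff₀ (by positivity), div_lt_div_iff₀ two_pos (by positivity)]
  constructor <;> intro h <;> linarith

theorem lt_alphaH_iff (hμ : ∀ j, 0 < μ j) (hρ : 0 < ρ) (hα : 0 < α) : α < alphaH μ ρ ↔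
    logCenter μ ρ (fun _ => Real.log α) < logCeiling μ (fun _ => Real.log α) := by
  rw [alphaH_eq, logCeiling_log μ hα]
  exact lt_div_norm2_iff hμ hρ hα _

theorem alphaH_lt_iff (hμ : ∀ j, 0 < μ j) (hρ : 0 < ρ) (hα : 0 < α) : alphaH μ ρ < α ↔
    logCeiling μ (fun _ => Real.log α) < logCenter μ ρ (fun _ => Real.log α) := by
  rw [alphaH_eq, logCeiling_log μ hα]
  exact div_norm2_lt_iff hμ hρ hα _

theorem alphaH_pos (hμ : ∀ j, 0 < μ j) (hρ : 0 < ρ) : 0 < alphaH μ ρ :=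
  div_pos (mul_pos hρ (sum_pow_pos hμ 4))
    (mul_pos (mul_pos (Real.sqrt_pos.2 two_pos) (norm2_pos hμ)) (sum_pow_pos hμ 3))

end InitialValues

section Thresholds

variable {k : ℕ} {μ : Fin (k + 2) → ℝ} {ρ α : ℝ}

theorem lt_alpha0_iff (hμ : ∀ j, 0 < μ j) (hρ : 0 < ρ) (hα : 0 < α) :
    α < alpha0 μ ρ ↔ logCenter μ ρ (fun _ => Real.log α) < mL μ :=
  lt_div_norm2_iff hμ hρ hα _

theorem alpha0_lt_iff (hμ : ∀ j, 0 < μ j) (hρ : 0 < ρ) (hα : 0 < α) :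
    alpha0 μ ρ < α ↔ mL μ < logCenter μ ρ (fun _ => Real.log α) :=
  div_norm2_lt_iff hμ hρ hα _

theorem lt_alpha2_iff (hμ : ∀ j, 0 < μ j) (hρ : 0 < ρ) (hα : 0 < α) :
    α < alpha2 μ ρ ↔ logCenter μ ρ (fun _ => Real.log α) < mTop μ :=
  lt_div_norm2_iff hμ hρ hα _

theorem alpha2_lt_iff (hμ : ∀ j, 0 < μ j) (hρ : 0 < ρ) (hα : 0 < α) :
    alpha2 μ ρ < α ↔ mTop μ < logCenter μ ρ (fun _ => Real.log α) :=
  div_norm2_lt_iff hμ hρ hα _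

theorem alpha0_pos (hμ : ∀ j, 0 < μ j) (hρ : 0 < ρ) : 0 < alpha0 μ ρ :=
  div_pos (mul_pos hρ (hμ 0)) (mul_pos (Real.sqrt_pos.2 two_pos) (norm2_pos hμ))

theorem alphaH_lt_alpha2 (hpos : ∀ j, 0 < μ j) (hμ : Monotone μ) (hρ : 0 < ρ) :
    alphaH μ ρ < alpha2 μ ρ := by
  have hN := norm2_pos hpos
  have hle : (∑ j, μ j ^ 4) / (∑ j, μ j ^ 3) ≤ μ (Fin.last (k + 1)) := by
    rw [div_le_iff₀ (sum_pow_pos hpos 3), Finset.mul_sum]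
    refine Finset.sum_le_sum fun j _ => ?_
    rw [pow_succ' _ 3]
    exact mul_le_mul_of_nonneg_right (hμ (Fin.le_last j)) (pow_nonneg (hpos j).le 3)
  have := hpos (Fin.last k).castSucc
  rw [alphaH_eq, alpha2]
  gcongr
  linarith

theorem exists_boundary_scale (hi : IsLeastFeature μ 0) (hρ : 0 < ρ) :
    ∃ α₁, alpha0 μ ρ < α₁ ∧ α₁ < alphaH μ ρ ∧ (∀ α, 0 < α →
      ((Visits (samField μ ρ) (belowFloor μ ρ 0) fun _ => Real.log α) ↔ α < α₁)) ∧
      ∀ α, 0 < α → ((Visits (samField μ ρ) (aboveCeiling μ ρ) fun _ => Real.log α) ↔ α₁ < α) := by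
  obtain ⟨a₁, hfloor, hceil⟩ := hi.exists_threshold hρ
  have hfloor' : ∀ α, 0 < α →
      ((Visits (samField μ ρ) (belowFloor μ ρ 0) fun _ => Real.log α) ↔ α < Real.exp a₁) :=
    fun α hα => (hfloor _).trans (Real.log_lt_iff_lt_exp hα)
  have hceil' : ∀ α, 0 < α →
      ((Visits (samField μ ρ) (aboveCeiling μ ρ) fun _ => Real.log α) ↔ Real.exp a₁ < α) :=
    fun α hα => (hceil _).trans (Real.lt_log_iff_exp_lt hα)
  have hpos := Real.exp_pos a₁
  refine ⟨_, (alpha0_lt_iff hi.all_pos hρ hpos).2 (not_le.1 fun hle => ?_),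
    (lt_alphaH_iff hi.all_pos hρ hpos).2 (not_le.1 fun hle => ?_), hfloor', hceil'⟩
  · exact lt_irrefl _ ((hfloor' _ hpos).1 (hi.visits_belowFloor hρ hle))
  · exact lt_irrefl _ ((hceil' _ hpos).1 (hi.visits_aboveCeiling hρ hle))

end Thresholds

section HittingTime

variable {T : EReal} {P : ℝ → Prop}

theorem hittingTime_eq_top (h : ∀ t ∈ lifespan T, ¬P t) : hittingTime T P = ⊤ := by
  have hempty : {t | t ∈ lifespan T ∧ P t} = ∅ :=
    eq_empty_of_forall_notMem fun t ht => h t ht.1 ht.2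
  rw [hittingTime, hempty, image_empty, sInf_empty]

theorem hittingTime_eq_coe {t₀ : ℝ} (ht₀ : t₀ ∈ lifespan T) (hP : P t₀)
    (h : ∀ t ∈ lifespan T, P t → t₀ ≤ t) : hittingTime T P = t₀ := by
  refine IsLeast.csInf_eq ⟨⟨t₀, ⟨ht₀, hP⟩, rfl⟩, ?_⟩
  rintro _ ⟨t, ⟨ht, hPt⟩, rfl⟩
  exact EReal.coe_le_coe_iff.2 (h t ht hPt)

end HittingTime

section Regimes

theorem IsMaximalFlow.exists_logCoordinates {d : ℕ} [Nonempty (Fin d)] {μ : Fin d → ℝ} {ρ α : ℝ}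
    {T : EReal} {θ : ℝ → Params d} (hμ : ∀ j, 0 < μ j) (hρ : 0 < ρ) (hα : 0 < α)
    (h : IsMaximalFlow μ ρ α T θ) :
    ∃ y, IsMaximalSolution (samField μ ρ) (fun _ => Real.log α) T y ∧
      (∀ t ∈ lifespan T, mc μ ρ (θ t) = logCenter μ ρ (y t)) ∧
      (∀ t ∈ lifespan T, mH μ (θ t) = logCeiling μ (y t)) ∧
      ∀ t ∈ lifespan T, ∀ j, beta (θ t) j = Real.exp (2 * y t j) := by
  obtain ⟨y, hy, hθ⟩ := h.exists_isMaximalSolution hμ hρ hα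
  exact ⟨y, hy, fun t ht => by rw [hθ t ht, mc_expParam],
    fun t ht => by rw [hθ t ht, mH_expParam hμ],
    fun t ht j => by rw [hθ t ht, beta_expParam]⟩

variable {k : ℕ} {μ : Fin (k + 2) → ℝ} {ρ α : ℝ} {T : EReal} {θ : ℝ → Params (k + 2)}

theorem IsMaximalFlow.below_floor (hi : IsLeastFeature μ 0) (hρ : 0 < ρ) (hα : 0 < α)
    (hlt : α < alpha0 μ ρ) (h : IsMaximalFlow μ ρ α T θ) :
    (∀ t ∈ lifespan T, mc μ ρ (θ t) < mL μ) ∧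
      StrictAntiOn (fun t => mc μ ρ (θ t)) (lifespan T) ∧
      ∀ j, ExpDecayOn (fun t => beta (θ t) j) (lifespan T) := by
  obtain ⟨y, hy, hm, -, hβ⟩ := h.exists_logCoordinates hi.all_pos hρ hα
  have hS := ordConnected_lifespan T
  have h0 := zero_mem_lifespan hy.pos
  have hstart : logCenter μ ρ (y 0) < mL μ := by
    rw [hy.start]
    exact (lt_alpha0_iff hi.all_pos hρ hα).1 hlt
  have hfloor : ∀ t ∈ lifespan T, logCenter μ ρ (y t) < mL μ := fun t ht =>
    ht.1.eq_or_lt.elim (fun h0t => h0t ▸ hstart)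
      fun h0t => hi.center_lt_floor hρ hS hy.isIntegralCurveOn h0 ht h0t hstart.le
  have hanti := strictAntiOn_logCenter hi.all_pos hρ hS hy.isIntegralCurveOn fun t ht =>
    (hfloor t (interior_subset ht)).trans (hi.floor_lt_logCeiling _)
  have hdecay := hi.expDecayOn hρ hS hy.isIntegralCurveOn ⟨h0, fun t ht => ht.1⟩ hstart
  exact ⟨fun t ht => hm t ht ▸ hfloor t ht, hanti.congr fun t ht => (hm t ht).symm,
    fun j => (hdecay j).congr fun t ht => (hβ t ht j).symm⟩

theorem IsMaximalFlow.trapped_of_not_visits (hi : IsLeastFeature μ 0) (hρ : 0 < ρ) (hα : 0 < α)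
    (hfloor : ¬Visits (samField μ ρ) (belowFloor μ ρ 0) fun _ => Real.log α)
    (hceil : ¬Visits (samField μ ρ) (aboveCeiling μ ρ) fun _ => Real.log α)
    (h : IsMaximalFlow μ ρ α T θ) :
    T = ⊤ ∧ ∀ t : ℝ, 0 ≤ t → mL μ < mc μ ρ (θ t) ∧ mc μ ρ (θ t) < mH μ (θ t) := by
  obtain ⟨y, hy, hm, hH, -⟩ := h.exists_logCoordinates hi.all_pos hρ hα
  obtain rfl := hi.eq_top_of_not_visits hρ hy hfloor
  refine ⟨rfl, fun t ht => ?_⟩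
  rw [← mem_Ici, ← lifespan_top] at ht
  rw [hm t ht, hH t ht]
  exact ⟨hi.floor_lt_logCenter_of_not_visits hρ hy hfloor ht,
    hi.logCenter_lt_logCeiling_of_not_visits hρ hy hceil ht⟩

theorem IsMaximalFlow.not_visits_of_trapped (hμ : ∀ j, 0 < μ j) (hρ : 0 < ρ) (hα : 0 < α)
    (h : IsMaximalFlow μ ρ α T θ)
    (htrap : ∀ t ∈ lifespan T, mL μ < mc μ ρ (θ t) ∧ mc μ ρ (θ t) < mH μ (θ t)) :
    (¬Visits (samField μ ρ) (belowFloor μ ρ 0) fun _ => Real.log α) ∧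
      ¬Visits (samField μ ρ) (aboveCeiling μ ρ) fun _ => Real.log α := by
  obtain ⟨y, hy, hm, hH, -⟩ := h.exists_logCoordinates hμ hρ hα
  have hf := (contDiff_samField hμ hρ).locallyLipschitz
  rw [hy.visits_iff hf, hy.visits_iff hf]
  constructor <;> rintro ⟨t, ht, hlt⟩
  · exact lt_asymm hlt (hm t ht ▸ (htrap t ht).1)
  · exact lt_asymm hlt (hm t ht ▸ hH t ht ▸ (htrap t ht).2)

theorem IsMaximalFlow.floor_first (hi : IsLeastFeature μ 0) (hρ : 0 < ρ)
    (hle : alpha0 μ ρ ≤ α)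
    (hv : Visits (samField μ ρ) (belowFloor μ ρ 0) fun _ => Real.log α)
    (h : IsMaximalFlow μ ρ α T θ) :
    tauF μ ρ T θ < tauG μ ρ T θ ∧ StrictAntiOn (fun t => mc μ ρ (θ t)) (lifespan T) ∧
      ∃ tF ∈ lifespan T, tauF μ ρ T θ = (tF : EReal) ∧ ∀ t₀ ∈ lifespan T, tF < t₀ →
        mc μ ρ (θ t₀) < mL μ ∧
        ∀ j, ExpDecayOn (fun t => beta (θ t) j) (lifespan T ∩ Ici t₀) := by
  have hα := (alpha0_pos hi.all_pos hρ).trans_le hle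
  obtain ⟨y, hy, hm, hH, hβ⟩ := h.exists_logCoordinates hi.all_pos hρ hα
  have hS := ordConnected_lifespan T
  have hint := hy.isIntegralCurveOn
  have hceil := fun t ht => hi.logCenter_lt_logCeiling_of_not_visits hρ hy (t := t)
    (disjoint_left.1 (hi.disjoint_visits hρ) hv) ht
  have hanti := strictAntiOn_logCenter hi.all_pos hρ hS hint
    fun t ht => hceil t (interior_subset ht)
  obtain ⟨tF, htF, heq⟩ := hi.exists_logCenter_eq_floor hρ hy hv
    (not_lt.1 fun hlt => hle.not_gt ((lt_alpha0_iff hi.all_pos hρ hα).2 hlt))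
  have hτF : tauF μ ρ T θ = tF := hittingTime_eq_coe htF ((hm tF htF).trans heq)
    fun t ht hPt => (hanti.injOn htF ht (heq.trans (hPt.symm.trans (hm t ht)))).le
  have hτG : tauG μ ρ T θ = ⊤ := hittingTime_eq_top fun t ht => by
    rw [hm t ht, hH t ht]
    exact (sub_neg.2 (hceil t ht)).ne
  refine ⟨by rw [hτF, hτG]; exact EReal.coe_lt_top tF, hanti.congr fun t ht => (hm t ht).symm,
    tF, htF, hτF, fun t₀ ht₀ hlt => ?_⟩
  have hfloor := hi.center_lt_floor hρ hS hint htF ht₀ hlt heq.le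
  have hdecay := hi.expDecayOn hρ (hS.inter ordConnected_Ici) (hint.mono inter_subset_left)
    ⟨⟨ht₀, self_mem_Ici⟩, fun t ht => ht.2⟩ hfloor
  exact ⟨hm t₀ ht₀ ▸ hfloor, fun j => (hdecay j).congr fun t ht => (hβ t ht.1 j).symm⟩

theorem IsMaximalFlow.ceiling_first (hi : IsLeastFeature μ 0) (hρ : 0 < ρ) (hα : 0 < α)
    (hle : α ≤ alphaH μ ρ)
    (hv : Visits (samField μ ρ) (aboveCeiling μ ρ) fun _ => Real.log α)
    (h : IsMaximalFlow μ ρ α T θ) :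
    T = ⊤ ∧ tauG μ ρ T θ < tauF μ ρ T θ ∧
      ∃ tG : ℝ, 0 ≤ tG ∧ tauG μ ρ T θ = (tG : EReal) ∧
        StrictAntiOn (fun t => mc μ ρ (θ t)) (Icc 0 tG) ∧
        StrictMonoOn (fun t => mc μ ρ (θ t)) (Ici tG) ∧
        ∀ t : ℝ, tG < t → mH μ (θ t) < mc μ ρ (θ t) := by
  obtain ⟨y, hy, hm, hH, -⟩ := h.exists_logCoordinates hi.all_pos hρ hα
  have hnv := disjoint_right.1 (hi.disjoint_visits hρ) hv
  obtain rfl := hi.eq_top_of_not_visits hρ hy hnv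
  obtain ⟨tG, htG, heq, hbefore, hafter⟩ := hi.exists_logCenter_eq_logCeiling hρ hy hv
    (not_lt.1 fun hlt => hle.not_gt ((alphaH_lt_iff hi.all_pos hρ hα).2 hlt))
  have hτG : tauG μ ρ ⊤ θ = tG := by
    refine hittingTime_eq_coe htG (by rw [hm tG htG, hH tG htG, heq, sub_self]) fun t ht hPt => ?_
    rw [hm t ht, hH t ht, sub_eq_zero] at hPt
    exact not_lt.1 fun hlt => (hbefore t ht hlt).ne hPt
  have hτF : tauF μ ρ ⊤ θ = ⊤ := hittingTime_eq_top fun t ht => by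
    rw [hm t ht]
    exact (hi.floor_lt_logCenter_of_not_visits hρ hy hnv ht).ne'
  have hsub : Icc 0 tG ⊆ lifespan ⊤ := Icc_subset_lifespan htG
  have hsub' : Ici tG ⊆ lifespan ⊤ := lifespan_top.symm ▸ Ici_subset_Ici.2 htG.1
  have hanti := strictAntiOn_logCenter hi.all_pos hρ ordConnected_Icc
    (hy.isIntegralCurveOn.mono hsub) fun t ht => by
      rw [interior_Icc] at ht
      exact hbefore t (hsub (Ioo_subset_Icc_self ht)) ht.2
  have hmono := strictMonoOn_logCenter hi.all_pos hρ ordConnected_Ici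
    (hy.isIntegralCurveOn.mono hsub') fun t ht => by
      rw [interior_Ici] at ht
      exact hafter t (hsub' (Ioi_subset_Ici_self ht)) ht
  refine ⟨rfl, by rw [hτF, hτG]; exact EReal.coe_lt_top tG, tG, htG.1, hτG,
    hanti.congr fun t ht => (hm t (hsub ht)).symm,
    hmono.congr fun t ht => (hm t (hsub' ht)).symm, fun t hlt => ?_⟩
  rw [hm t (hsub' hlt.le), hH t (hsub' hlt.le)]
  exact hafter t (hsub' hlt.le) hlt

theorem IsMaximalFlow.above_ceiling (hi : IsLeastFeature μ 0) (hρ : 0 < ρ)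
    (hlt : alphaH μ ρ < α) (h : IsMaximalFlow μ ρ α T θ) :
    T = ⊤ ∧ (∀ t : ℝ, 0 ≤ t → mH μ (θ t) < mc μ ρ (θ t)) ∧
      StrictMonoOn (fun t => mc μ ρ (θ t)) (Ici 0) := by
  have hα := (alphaH_pos hi.all_pos hρ).trans hlt
  obtain ⟨y, hy, hm, hH, -⟩ := h.exists_logCoordinates hi.all_pos hρ hα
  have hstart := (alphaH_lt_iff hi.all_pos hρ hα).1 hlt
  obtain rfl := hi.eq_top_of_not_visits hρ hy
    (disjoint_right.1 (hi.disjoint_visits hρ) (hi.visits_aboveCeiling hρ hstart.le))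
  have hint := hy.isIntegralCurveOn
  rw [← hy.start] at hstart
  rw [lifespan_top] at hint hm hH
  have hceil : ∀ t ∈ Ici (0 : ℝ), logCeiling μ (y t) < logCenter μ ρ (y t) := fun t ht =>
    (mem_Ici.1 ht).eq_or_lt.elim (fun h0t => h0t ▸ hstart)
      fun h0t => hi.ceiling_lt_center hρ ordConnected_Ici hint self_mem_Ici ht h0t hstart.le
  have hmono := strictMonoOn_logCenter hi.all_pos hρ ordConnected_Ici hint
    fun t ht => hceil t (interior_subset ht)
  exact ⟨rfl, fun t ht => by rw [hm t ht, hH t ht]; exact hceil t ht,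
    hmono.congr fun t ht => (hm t ht).symm⟩

theorem IsMaximalFlow.top_threshold (hi : IsLeastFeature μ 0) (hμ : Monotone μ) (hρ : 0 < ρ)
    (hα : 0 < α) (h : IsMaximalFlow μ ρ α T θ) :
    (α < alpha2 μ ρ ↔ mc μ ρ (θ 0) < mTop μ) ∧ (alpha2 μ ρ < α ↔ mTop μ < mc μ ρ (θ 0)) ∧
      (alpha2 μ ρ < α → ∀ t : ℝ, 0 ≤ t → mTop μ < mc μ ρ (θ t)) := by
  obtain ⟨y, hy, hm, -, -⟩ := h.exists_logCoordinates hi.all_pos hρ hα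
  rw [hm 0 (zero_mem_lifespan hy.pos), hy.start]
  have hiff := alpha2_lt_iff hi.all_pos hρ hα
  refine ⟨lt_alpha2_iff hi.all_pos hρ hα, hiff, fun hlt t ht => ?_⟩
  obtain ⟨-, -, hmono⟩ :=
    h.above_ceiling hi hρ ((alphaH_lt_alpha2 hi.all_pos hμ hρ).trans hlt)
  have hstart : mTop μ < mc μ ρ (θ 0) := by
    rw [hm 0 (zero_mem_lifespan hy.pos), hy.start]
    exact hiff.1 hlt
  exact hstart.trans_le (hmono.monotoneOn self_mem_Ici ht ht)

end Regimes

end SAMFlow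

end

open SAMFlow in
theorem mainTheorem1_general (k : ℕ) (μ : Fin (k + 2) → ℝ) (hμpos : 0 < μ 0) (hμ : Monotone μ)
    (hne : μ 0 < μ (Fin.last (k + 1))) (ρ : ℝ) (hρ : 0 < ρ) :
    (∀ α : ℝ, 0 < α → ∃ T θ, IsMaximalFlow μ ρ α T θ) ∧
    (∀ α : ℝ, 0 < α → α < alpha0 μ ρ →
      ∀ T θ, IsMaximalFlow μ ρ α T θ →
        (∀ t ∈ lifespan T, mc μ ρ (θ t) < mL μ) ∧
        StrictAntiOn (fun t => mc μ ρ (θ t)) (lifespan T) ∧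
        ∀ j, ExpDecayOn (fun t => beta (θ t) j) (lifespan T)) ∧
    (∃ α₁ : ℝ, alpha0 μ ρ < α₁ ∧ α₁ < alphaH μ ρ ∧
      (∀ T θ, IsMaximalFlow μ ρ α₁ T θ →
        T = ⊤ ∧ ∀ t : ℝ, 0 ≤ t → mL μ < mc μ ρ (θ t) ∧ mc μ ρ (θ t) < mH μ (θ t)) ∧
      (∀ α : ℝ, 0 < α → ∀ T θ, IsMaximalFlow μ ρ α T θ →
        (∀ t ∈ lifespan T, mL μ < mc μ ρ (θ t) ∧ mc μ ρ (θ t) < mH μ (θ t)) → α = α₁) ∧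
      (∀ α : ℝ, alpha0 μ ρ ≤ α → α < α₁ →
        ∀ T θ, IsMaximalFlow μ ρ α T θ →
          tauF μ ρ T θ < tauG μ ρ T θ ∧
          StrictAntiOn (fun t => mc μ ρ (θ t)) (lifespan T) ∧
          ∃ tF ∈ lifespan T, tauF μ ρ T θ = (tF : EReal) ∧
            ∀ t₀ ∈ lifespan T, tF < t₀ →
              mc μ ρ (θ t₀) < mL μ ∧
              ∀ j, ExpDecayOn (fun t => beta (θ t) j) (lifespan T ∩ Set.Ici t₀)) ∧
      (∀ α : ℝ, α₁ < α → α ≤ alphaH μ ρ →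
        ∀ T θ, IsMaximalFlow μ ρ α T θ →
          T = ⊤ ∧ tauG μ ρ T θ < tauF μ ρ T θ ∧
          ∃ tG : ℝ, 0 ≤ tG ∧ tauG μ ρ T θ = (tG : EReal) ∧
            StrictAntiOn (fun t => mc μ ρ (θ t)) (Set.Icc 0 tG) ∧
            StrictMonoOn (fun t => mc μ ρ (θ t)) (Set.Ici tG) ∧
            ∀ t : ℝ, tG < t → mH μ (θ t) < mc μ ρ (θ t))) ∧
    (∀ α : ℝ, alphaH μ ρ < α →
      ∀ T θ, IsMaximalFlow μ ρ α T θ →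
        T = ⊤ ∧ (∀ t : ℝ, 0 ≤ t → mH μ (θ t) < mc μ ρ (θ t)) ∧
        StrictMonoOn (fun t => mc μ ρ (θ t)) (Set.Ici 0)) ∧
    alphaH μ ρ < alpha2 μ ρ ∧
    (∀ α : ℝ, 0 < α → ∀ T θ, IsMaximalFlow μ ρ α T θ →
      (α < alpha2 μ ρ ↔ mc μ ρ (θ 0) < mTop μ) ∧
      (alpha2 μ ρ < α ↔ mTop μ < mc μ ρ (θ 0)) ∧
      (alpha2 μ ρ < α → ∀ t : ℝ, 0 ≤ t → mTop μ < mc μ ρ (θ t))) := by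
  have hi : IsLeastFeature μ 0 := ⟨hμpos, fun j => hμ (Fin.zero_le j), Fin.last (k + 1), hne⟩
  obtain ⟨α₁, h0, hH, hfloor, hceil⟩ := exists_boundary_scale hi hρ
  have h0pos := alpha0_pos hi.all_pos hρ
  have hα₁ := h0pos.trans h0
  refine ⟨fun α hα => exists_isMaximalFlow hi.all_pos hρ hα,
    fun α hα hlt T θ h => h.below_floor hi hρ hα hlt,
    ⟨α₁, h0, hH, fun T θ h => ?boundary, fun α hα T θ h htrap => ?unique,
      fun α hle hlt T θ h => ?floor, fun α hlt hle T θ h => ?ceiling⟩,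
    fun α hlt T θ h => h.above_ceiling hi hρ hlt, alphaH_lt_alpha2 hi.all_pos hμ hρ,
    fun α hα T θ h => h.top_threshold hi hμ hρ hα⟩
  case boundary =>
    exact h.trapped_of_not_visits hi hρ hα₁ (mt (hfloor α₁ hα₁).1 (lt_irrefl α₁))
      (mt (hceil α₁ hα₁).1 (lt_irrefl α₁))
  case unique =>
    obtain ⟨hnfloor, hnceil⟩ := h.not_visits_of_trapped hi.all_pos hρ hα htrap
    rw [hfloor α hα, not_lt] at hnfloor
    rw [hceil α hα, not_lt] at hnceil
    exact le_antisymm hnceil hnfloor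
  case floor => exact h.floor_first hi hρ hle ((hfloor α (h0pos.trans_le hle)).2 hlt)
  case ceiling =>
    have hα := hα₁.trans hlt
    exact h.ceiling_first hi hρ hα hle ((hceil α hα).2 hlt)

theorem mainTheorem1 (k : ℕ) (μ : Fin (k + 2) → ℝ) (hμpos : 0 < μ 0) (hμ : StrictMono μ)
    (ρ : ℝ) (hρ : 0 < ρ) :
    -- every initialization scale has a maximal trajectory
    (∀ α : ℝ, 0 < α → ∃ T θ, SAMFlow.IsMaximalFlow μ ρ α T θ) ∧
    -- Regime 1-a
    (∀ α : ℝ, 0 < α → α < SAMFlow.alpha0 μ ρ →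
      ∀ T θ, SAMFlow.IsMaximalFlow μ ρ α T θ →
        (∀ t ∈ SAMFlow.lifespan T, SAMFlow.mc μ ρ (θ t) < SAMFlow.mL μ) ∧
        StrictAntiOn (fun t => SAMFlow.mc μ ρ (θ t)) (SAMFlow.lifespan T) ∧
        ∀ j, SAMFlow.ExpDecayOn (fun t => SAMFlow.beta (θ t) j) (SAMFlow.lifespan T)) ∧
    -- the boundary scale `α₁`
    (∃ α₁ : ℝ, SAMFlow.alpha0 μ ρ < α₁ ∧ α₁ < SAMFlow.alphaH μ ρ ∧
      (∀ T θ, SAMFlow.IsMaximalFlow μ ρ α₁ T θ →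
        T = ⊤ ∧ ∀ t : ℝ, 0 ≤ t →
          SAMFlow.mL μ < SAMFlow.mc μ ρ (θ t) ∧ SAMFlow.mc μ ρ (θ t) < SAMFlow.mH μ (θ t)) ∧
      (∀ α : ℝ, 0 < α → ∀ T θ, SAMFlow.IsMaximalFlow μ ρ α T θ →
        (∀ t ∈ SAMFlow.lifespan T,
          SAMFlow.mL μ < SAMFlow.mc μ ρ (θ t) ∧ SAMFlow.mc μ ρ (θ t) < SAMFlow.mH μ (θ t)) →
        α = α₁) ∧
      -- Regime 1-b: floor first
      (∀ α : ℝ, SAMFlow.alpha0 μ ρ ≤ α → α < α₁ →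
        ∀ T θ, SAMFlow.IsMaximalFlow μ ρ α T θ →
          SAMFlow.tauF μ ρ T θ < SAMFlow.tauG μ ρ T θ ∧
          StrictAntiOn (fun t => SAMFlow.mc μ ρ (θ t)) (SAMFlow.lifespan T) ∧
          ∃ tF ∈ SAMFlow.lifespan T, SAMFlow.tauF μ ρ T θ = (tF : EReal) ∧
            ∀ t₀ ∈ SAMFlow.lifespan T, tF < t₀ →
              SAMFlow.mc μ ρ (θ t₀) < SAMFlow.mL μ ∧
              ∀ j, SAMFlow.ExpDecayOn (fun t => SAMFlow.beta (θ t) j)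
                (SAMFlow.lifespan T ∩ Set.Ici t₀)) ∧
      -- Regime 2-a: ceiling first
      (∀ α : ℝ, α₁ < α → α ≤ SAMFlow.alphaH μ ρ →
        ∀ T θ, SAMFlow.IsMaximalFlow μ ρ α T θ →
          T = ⊤ ∧
          SAMFlow.tauG μ ρ T θ < SAMFlow.tauF μ ρ T θ ∧
          ∃ tG : ℝ, 0 ≤ tG ∧ SAMFlow.tauG μ ρ T θ = (tG : EReal) ∧
            StrictAntiOn (fun t => SAMFlow.mc μ ρ (θ t)) (Set.Icc 0 tG) ∧
            StrictMonoOn (fun t => SAMFlow.mc μ ρ (θ t)) (Set.Ici tG) ∧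
            ∀ t : ℝ, tG < t → SAMFlow.mH μ (θ t) < SAMFlow.mc μ ρ (θ t))) ∧
    -- Regimes 2-b and 3
    (∀ α : ℝ, SAMFlow.alphaH μ ρ < α →
      ∀ T θ, SAMFlow.IsMaximalFlow μ ρ α T θ →
        T = ⊤ ∧
        (∀ t : ℝ, 0 ≤ t → SAMFlow.mH μ (θ t) < SAMFlow.mc μ ρ (θ t)) ∧
        StrictMonoOn (fun t => SAMFlow.mc μ ρ (θ t)) (Set.Ici 0)) ∧
    -- the threshold `α₂` between Regimes 2 and 3
    SAMFlow.alphaH μ ρ < SAMFlow.alpha2 μ ρ ∧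
    (∀ α : ℝ, 0 < α → ∀ T θ, SAMFlow.IsMaximalFlow μ ρ α T θ →
      (α < SAMFlow.alpha2 μ ρ ↔ SAMFlow.mc μ ρ (θ 0) < SAMFlow.mTop μ) ∧
      (SAMFlow.alpha2 μ ρ < α ↔ SAMFlow.mTop μ < SAMFlow.mc μ ρ (θ 0)) ∧
      (SAMFlow.alpha2 μ ρ < α →
        ∀ t : ℝ, 0 ≤ t → SAMFlow.mTop μ < SAMFlow.mc μ ρ (θ t))) := by
  exact mainTheorem1_general k μ hμpos hμ.monotone (hμ (Fin.last_pos)) ρ hρ
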